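/- **Notation.** Let $\mathcal{H}_{4,4}$ be the space of real quartic forms in $(a,b,c,d)=(a_0,a_1,a_2,a_3)$, $\mathcal{P}_{4,4}\subset\mathcal{H}_{4,4}$ the cone of forms that are nonnegative on $\mathbb{R}^4$ (PSD), $\mathcal{P}_{4,4}^s$ the cone of symmetric forms in $\mathcal{P}_{4,4}$, and $\Sigma_{4,4}$ the cone of finite sums of squares of real quadratic forms. An element $f\neq 0$ of $\mathcal{P}_{4,4}$ is *extremal*, written $f\in\mathcal{E}(\mathcal{P}_{4,4})$, if $f=g+h$ with $g,h\in\mathcal{P}_{4,4}$ implies $g,h\in\mathbb{R}_{\ge 0}\cdot f$. For a form $f$ let $V_{\mathbb{R}}(f)\subset\mathbb{P}^3_{\mathbb{R}}$ be its set of real projective zeros. Put $$s_0=\sum_i a_i^4-4abcd,\quad s_1=\sum_{i\ne j}a_i^3a_j-12abcd,\quad s_2=\sum_{i<j}a_i^2a_j^2-6abcd,\quad s_3=\sum_{i}\ \sum_{j<k;\ j,k\neq i}a_i^2a_ja_k-12abcd,\quad s_4=abcd,$$ and, for $u\neq 0$, $\omega(u)=u+\frac1u-2$. Put $$\begin{aligned}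 p_0(t,w)&=(4t+2)w^2-3(t-1)^2w,\\ p_1(t,w)&=-2(t+1)^2w^2+2(t+1)(t-1)^2w,\\ p_2(t,w)&=4t^2w^2-2(t-1)^2(2t-1)w+2(t-1)^4,\\ p_3(t,w)&=2(t+1)^2w^2-(t-1)^2(t^2+3)w-2(t-1)^4,\\ p_4(t,w)&=2(t-1)^4w^2, \end{aligned}$$ $$\mathfrak{g}_{t,u}=u^2\sum_{i=0}^4p_i(t,\omega(u))\,s_i,\qquad V_F(t,w)=(3+6t-t^2)w^2-6(t-1)^2w,$$ $$D_F(t,u)=(3+6t-t^2)-(13+6t+5t^2)u+(10+9t+4t^2+t^3)u^2-(1+6t+t^2)u^3,$$ and let $\mathcal{U}\subset\mathbb{R}^2$ be the set of all $(t,u)$ with $t\notin\{0,1\}$, $u\notin\{0,1,-1\}$, $2u\neq t+1$, $tu+u\neq 2$, $D_F(t,u)\neq 0$ and $V_F(t,\omega(u))>0$. **Theorem.** (A) The set $\mathcal{U}$ is open and non-empty, and for every $(t,u)\in\mathcal{U}$: 1. $\mathfrak{g}_{t,u}\in\mathcal{P}_{4,4}^s$, $\mathfrak{g}_{t,u}(t,1,1,1)=0$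 and $\mathfrak{g}_{t,u}(u,u,1,1)=0$; 2. $\mathfrak{g}_{t,u}\in\mathcal{E}(\mathcal{P}_{4,4})$ and $\mathfrak{g}_{t,u}\notin\Sigma_{4,4}$; 3. $\mathfrak{g}_{t,u}$ is irreducible in $\mathbb{C}[a,b,c,d]$; 4. $V_{\mathbb{R}}(\mathfrak{g}_{t,u})$ consists of exactly 10 points, each of them isolated. (B) If $t\in\mathbb{R}$ and $u\in\mathbb{R}\setminus\{0,1\}$, then $\mathfrak{g}_{t,u}\in\mathcal{P}_{4,4}^s$ if and only if $V_F(t,\omega(u))\ge 0$. Moreover, $-\mathfrak{g}_{t,u}\notin\mathcal{P}_{4,4}^s$ for all $t\in\mathbb{R}$ and $u\neq 0$ with $(t,u)\neq(1,1)$. (C) If $t\neq 1$, $u\notin\{0,1,-1\}$, $V_F(t,\omega(u))>0$ and $\mathfrak{g}_{t,u}\in\mathcal{E}(\mathcal{P}_{4,4})$, then $\mathfrak{g}_{t,u}$ is irreducible in $\mathbb{C}[a,b,c,d]$ and $\mathfrak{g}_{t,u}\notin\Sigma_{4,4}$. -/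

import Mathlib

open MvPolynomial

noncomputable section

namespace SymQuartic

/-! ### Forms, PSD cones, extremal elements, sums of squares -/

/-- Forms of degree `d` in `n` real variables. -/
abbrev Forms (n d : ℕ) : Submodule ℝ (MvPolynomial (Fin n) ℝ) :=
  homogeneousSubmodule (Fin n) ℝ d

/-- Symmetric forms of degree `d` in `n` real variables. -/
def SymForms (n d : ℕ) : Submodule ℝ (MvPolynomial (Fin n) ℝ) :=
  Forms n d ⊓ Subalgebra.toSubmodule (symmetricSubalgebra (Fin n) ℝ)

/-- The PSD cone on `A` in `H`: the elements of `H` that are nonnegative at every point of `A`. -/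
def psdCone {n : ℕ} (A : Set (Fin n → ℝ)) (H : Submodule ℝ (MvPolynomial (Fin n) ℝ)) :
    Set (MvPolynomial (Fin n) ℝ) :=
  {f | f ∈ H ∧ ∀ a ∈ A, 0 ≤ eval a f}

/-- The cone of PSD forms of degree `d` in `n` variables. -/
def PSD (n d : ℕ) : Set (MvPolynomial (Fin n) ℝ) := psdCone Set.univ (Forms n d)

/-- The cone of symmetric PSD forms of degree `d` in `n` variables. -/
def SymPSD (n d : ℕ) : Set (MvPolynomial (Fin n) ℝ) := psdCone Set.univ (SymForms n d)

/-- The extremal elements of a cone `P`: the nonzero `f ∈ P` such that `f = g + h` with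
`g, h ∈ P` forces `g` and `h` to be nonnegative multiples of `f`. -/
def extremals {E : Type*} [AddCommGroup E] [Module ℝ E] (P : Set E) : Set E :=
  {f | f ∈ P ∧ f ≠ 0 ∧ ∀ g ∈ P, ∀ h ∈ P, g + h = f →
    (∃ α : ℝ, 0 ≤ α ∧ g = α • f) ∧ (∃ β : ℝ, 0 ≤ β ∧ h = β • f)}

/-- The forms of degree `2 * d` in `n` variables that are finite sums of squares of forms of
degree `d`. -/
def SOS (n d : ℕ) : Set (MvPolynomial (Fin n) ℝ) :=
  {f | ∃ (r : ℕ) (g : Fin r → MvPolynomial (Fin n) ℝ),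
    (∀ i, g i ∈ Forms n d) ∧ f = ∑ i, g i ^ 2}

/-! ### Real projective space and real zero sets -/

/-- Real projective space of dimension `n - 1`. -/
abbrev RealProj (n : ℕ) : Type := Projectivization ℝ (Fin n → ℝ)

/-- The usual topology of real projective space: the quotient topology from `ℝⁿ ∖ {0}`. -/
instance instTopologicalSpaceRealProj (n : ℕ) : TopologicalSpace (RealProj n) :=
  TopologicalSpace.coinduced
    (fun v : {v : Fin n → ℝ // v ≠ 0} => Projectivization.mk ℝ v.1 v.2) inferInstance

/-- The set of real projective zeros of a form `f`: the points all of whose homogeneous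
coordinate vectors are zeros of `f`. -/
def realZeros {n : ℕ} (f : MvPolynomial (Fin n) ℝ) : Set (RealProj n) :=
  {p | ∀ (v : Fin n → ℝ) (hv : v ≠ 0), Projectivization.mk ℝ v hv = p → eval v f = 0}

/-! ### The quartics; indices in `Fin 4` are cyclic -/

/-- `a⁴ + b⁴ + c⁴ + d⁴` -/
def S4 : MvPolynomial (Fin 4) ℝ := ∑ i, X i ^ 4

/-- `∑ aᵢ³ aⱼ` over ordered pairs `i ≠ j` -/
def T31 : MvPolynomial (Fin 4) ℝ := ∑ i, X i ^ 3 * (X (i + 1) + X (i + 2) + X (i + 3))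

/-- `∑ aᵢ² aⱼ²` over `i < j` -/
def S22 : MvPolynomial (Fin 4) ℝ := ∑ i, ∑ j ∈ Finset.Ioi i, X i ^ 2 * X j ^ 2

/-- `∑ aᵢ² aⱼ aₖ` over `i` and `j < k` different from `i` -/
def T211 : MvPolynomial (Fin 4) ℝ :=
  ∑ i, X i ^ 2 * (X (i + 1) * X (i + 2) + X (i + 1) * X (i + 3) + X (i + 2) * X (i + 3))

/-- `a b c d` -/
def U4 : MvPolynomial (Fin 4) ℝ := X 0 * X 1 * X 2 * X 3

def s0 : MvPolynomial (Fin 4) ℝ := S4 - 4 * U4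
def s1 : MvPolynomial (Fin 4) ℝ := T31 - 12 * U4
def s2 : MvPolynomial (Fin 4) ℝ := S22 - 6 * U4
def s3 : MvPolynomial (Fin 4) ℝ := T211 - 12 * U4
def s4 : MvPolynomial (Fin 4) ℝ := U4

/-- Meaningful for `u ≠ 0` only. -/
def omega (u : ℝ) : ℝ := u + 1 / u - 2

def p0 (t w : ℝ) : ℝ := (4 * t + 2) * w ^ 2 - 3 * (t - 1) ^ 2 * w
def p1 (t w : ℝ) : ℝ := -2 * (t + 1) ^ 2 * w ^ 2 + 2 * (t + 1) * (t - 1) ^ 2 * w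
def p2 (t w : ℝ) : ℝ :=
  4 * t ^ 2 * w ^ 2 - 2 * (t - 1) ^ 2 * (2 * t - 1) * w + 2 * (t - 1) ^ 4
def p3 (t w : ℝ) : ℝ :=
  2 * (t + 1) ^ 2 * w ^ 2 - (t - 1) ^ 2 * (t ^ 2 + 3) * w - 2 * (t - 1) ^ 4
def p4 (t w : ℝ) : ℝ := 2 * (t - 1) ^ 4 * w ^ 2

/-- The symmetric quaternary quartic `𝔤_{t,u}`. -/
def quartic (t u : ℝ) : MvPolynomial (Fin 4) ℝ :=
  C (u ^ 2) * (C (p0 t (omega u)) * s0 + C (p1 t (omega u)) * s1 + C (p2 t (omega u)) * s2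
    + C (p3 t (omega u)) * s3 + C (p4 t (omega u)) * s4)

def VF (t w : ℝ) : ℝ := (3 + 6 * t - t ^ 2) * w ^ 2 - 6 * (t - 1) ^ 2 * w

def DF (t u : ℝ) : ℝ :=
  (3 + 6 * t - t ^ 2) - (13 + 6 * t + 5 * t ^ 2) * u
    + (10 + 9 * t + 4 * t ^ 2 + t ^ 3) * u ^ 2 - (1 + 6 * t + t ^ 2) * u ^ 3

/-- The parameter set `𝒰 ⊆ ℝ²` of pairs `(t, u)`. -/
def paramSet : Set (ℝ × ℝ) :=
  {x | x.1 ≠ 0 ∧ x.1 ≠ 1 ∧ x.2 ≠ 0 ∧ x.2 ≠ 1 ∧ x.2 ≠ -1 ∧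
    2 * x.2 ≠ x.1 + 1 ∧ x.1 * x.2 + x.2 ≠ 2 ∧ DF x.1 x.2 ≠ 0 ∧ 0 < VF x.1 (omega x.2)}

end SymQuartic

end

/-! Write `f` for the quartic without its factor `u²`, and put `w = ω(u)`. Two facts control its
sign. On the plane `a = b` it is a square plus `V_F/2` times a square (`quarticFun_diag`). For fixed
`e₁, e₂, e₃` it is affine in `e₄ = abcd` (`exists_quarticFun_eq_affine`). Four distinct reals are
the roots of a monic quartic, and changing `e₄` shifts its graph vertically. The graph can be
shifted up and down, keeping all roots real, until two roots collide. An affine function on the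
resulting interval is bounded below by one of its end values, and these lie on the planes of equal
coordinates. So `V_F ≥ 0` gives nonnegativity, while for `V_F < 0` a perturbation of `(1,1,u,u)` or
`(u,u,1,1)` gives a negative value. If `V_F > 0` and `t ≠ 1`, the two squares vanish together only
at the permutations of `(t,1,1,1)` and `(u,u,1,1)`, up to scaling. These are 4 + 6 = 10 projective
points when also `u ≠ 0, 1, -1`.

Extremality: a PSD summand of `f` vanishes to second order at all these points. The forms that do so
make up a space of dimension at most one, because such a form vanishing also at `(1,1,1,1)` is zero
(`eq_zero_of_eval_one_eq_zero`). The core is that each of them is symmetric: the part antisymmetric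
under a transposition is divisible by a linear form, and the conditions left on the cofactor kill
it.

Irreducibility and failure to be a sum of squares need only extremality and the number of zeros. A
real quadratic form in four variables with finitely many projective zeros has at most one
(`realZeros_quadratic_subsingleton`), so an extremal form with 10 zeros dominates no nonzero square.
A complex linear factor would give a real line of zeros. For a product of two quadratics,
conjugation either fixes both factors up to constants, leaving at most two real zeros, or exchanges
them, making the form a sum of two squares. -/

noncomputable section

namespace SymQuartic

/-! ### The quartic as a real function -/

/-- The value of the quartic, without the factor `u²`, in terms of `t` and `w = ω(u)`. -/
def quarticFun (t w a b c d : ℝ) : ℝ :=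
  p0 t w * (a ^ 4 + b ^ 4 + c ^ 4 + d ^ 4 - 4 * (a * b * c * d))
  + p1 t w * (a ^ 3 * (b + c + d) + b ^ 3 * (c + d + a) + c ^ 3 * (d + a + b)
      + d ^ 3 * (a + b + c) - 12 * (a * b * c * d))
  + p2 t w * (a ^ 2 * b ^ 2 + a ^ 2 * c ^ 2 + a ^ 2 * d ^ 2 + b ^ 2 * c ^ 2 + b ^ 2 * d ^ 2
      + c ^ 2 * d ^ 2 - 6 * (a * b * c * d))
  + p3 t w * (a ^ 2 * (b * c + b * d + c * d) + b ^ 2 * (c * d + c * a + d * a)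
      + c ^ 2 * (d * a + d * b + a * b) + d ^ 2 * (a * b + a * c + b * c) - 12 * (a * b * c * d))
  + p4 t w * (a * b * c * d)

theorem eval_S4 (v : Fin 4 → ℝ) : eval v S4 = v 0 ^ 4 + v 1 ^ 4 + v 2 ^ 4 + v 3 ^ 4 := by
  simp [S4, Fin.sum_univ_four]

theorem eval_T31 (v : Fin 4 → ℝ) : eval v T31 = v 0 ^ 3 * (v 1 + v 2 + v 3)
    + v 1 ^ 3 * (v 2 + v 3 + v 0) + v 2 ^ 3 * (v 3 + v 0 + v 1) + v 3 ^ 3 * (v 0 + v 1 + v 2) := by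
  simp only [T31, Fin.sum_univ_four, map_add, map_mul, map_pow, eval_X]
  rfl

theorem S22_eq : S22 = X 0 ^ 2 * X 1 ^ 2 + X 0 ^ 2 * X 2 ^ 2 + X 0 ^ 2 * X 3 ^ 2
    + X 1 ^ 2 * X 2 ^ 2 + X 1 ^ 2 * X 3 ^ 2 + X 2 ^ 2 * X 3 ^ 2 := by
  have h0 : Finset.Ioi (0 : Fin 4) = {1, 2, 3} := by decide
  have h1 : Finset.Ioi (1 : Fin 4) = {2, 3} := by decide
  have h2 : Finset.Ioi (2 : Fin 4) = {3} := by decide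
  have h3 : Finset.Ioi (3 : Fin 4) = ∅ := by decide
  simp only [S22, Fin.sum_univ_four, h0, h1, h2, h3]
  simp
  ring

theorem eval_T211 (v : Fin 4 → ℝ) : eval v T211 = v 0 ^ 2 * (v 1 * v 2 + v 1 * v 3 + v 2 * v 3)
    + v 1 ^ 2 * (v 2 * v 3 + v 2 * v 0 + v 3 * v 0) + v 2 ^ 2 * (v 3 * v 0 + v 3 * v 1 + v 0 * v 1)
    + v 3 ^ 2 * (v 0 * v 1 + v 0 * v 2 + v 1 * v 2) := by
  simp only [T211, Fin.sum_univ_four, map_add, map_mul, map_pow, eval_X]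
  rfl

theorem eval_quartic (t u : ℝ) (v : Fin 4 → ℝ) :
    eval v (quartic t u) = u ^ 2 * quarticFun t (omega u) (v 0) (v 1) (v 2) (v 3) := by
  simp only [quartic, s0, s1, s2, s3, s4, U4, S22_eq, map_add, map_sub, map_mul, map_pow, eval_C,
    eval_S4, eval_T31, eval_T211, eval_X, map_ofNat, quarticFun]

/-- On the plane `a = b` the quartic is a square plus a multiple of `V_F`. -/
theorem quarticFun_diag (t w x y z : ℝ) :
    quarticFun t w x x y z =
      ((2 * (t + 1) * w - (t - 1) ^ 2) * (y - z) ^ 2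
        + (t - 1) ^ 2 * ((y + z) ^ 2 - 2 * (w + 2) * (y + z) * x + 4 * x ^ 2)) ^ 2 / 8
      + VF t w * (y - z) ^ 2 * (y + z - (t + 1) * x) ^ 2 / 2 := by
  simp only [quarticFun, p0, p1, p2, p3, p4, VF]
  ring

/-- For fixed `e₁, e₂, e₃` the quartic is an affine function of `e₄ = abcd`. -/
theorem exists_quarticFun_eq_affine (t w : ℝ) : ∃ (φ : ℝ → ℝ → ℝ → ℝ) (ε : ℝ), ∀ a b c d : ℝ,
    quarticFun t w a b c d = φ (a + b + c + d) (a * b + a * c + a * d + b * c + b * d + c * d)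
      (a * b * c + a * b * d + a * c * d + b * c * d) + ε * (a * b * c * d) := by
  refine ⟨fun e f g => p0 t w * (e ^ 4 - 4 * e ^ 2 * f + 2 * f ^ 2 + 4 * e * g)
    + p1 t w * (e ^ 2 * f - 2 * f ^ 2 - e * g) + p2 t w * (f ^ 2 - 2 * e * g) + p3 t w * (e * g),
    -8 * p0 t w - 8 * p1 t w - 4 * p2 t w - 16 * p3 t w + p4 t w, fun a b c d => ?_⟩
  simp only [quarticFun]
  ring

/-! ### Moving four distinct reals to a double root with `e₁, e₂, e₃` fixed -/

theorem exists_roots_of_quadratic {β γ s : ℝ} (h : s ^ 2 + β * s + γ ≤ 0) :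
    ∃ y z : ℝ, β = -(y + z) ∧ γ = y * z := by
  have hD : 0 ≤ β ^ 2 - 4 * γ := by nlinarith [sq_nonneg (2 * s + β)]
  refine ⟨(-β - √(β ^ 2 - 4 * γ)) / 2, (-β + √(β ^ 2 - 4 * γ)) / 2, by ring, ?_⟩
  nlinarith [Real.sq_sqrt hD]

/-- The monic real quartic `P` with roots `a, b, c, d`. -/
def rootQuartic (a b c d X : ℝ) : ℝ := (X - a) * (X - b) * (X - c) * (X - d)

theorem hasDerivAt_rootQuartic (a b c d x : ℝ) : HasDerivAt (rootQuartic a b c d)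
    (4 * x ^ 3 - 3 * (a + b + c + d) * x ^ 2
      + 2 * (a * b + a * c + a * d + b * c + b * d + c * d) * x
      - (a * b * c + a * b * d + a * c * d + b * c * d)) x := by
  have h := ((((hasDerivAt_id x).sub_const a).mul ((hasDerivAt_id x).sub_const b)).mul
    ((hasDerivAt_id x).sub_const c)).mul ((hasDerivAt_id x).sub_const d)
  refine HasDerivAt.congr_deriv (f := rootQuartic a b c d) h ?_
  simp
  ring

/-- If `P - P(x)` has a double root at `x` and takes a value `≤ 0` elsewhere, then it has only
real roots `x, x, y, z`. -/
theorem exists_double_root {a b c d x s : ℝ}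
    (hd : deriv (rootQuartic a b c d) x = 0) (hs : s ≠ x)
    (h : rootQuartic a b c d s ≤ rootQuartic a b c d x) :
    ∃ y z : ℝ, a + b + c + d = x + x + y + z ∧
      a * b + a * c + a * d + b * c + b * d + c * d
        = x * x + x * y + x * z + x * y + x * z + y * z ∧
      a * b * c + a * b * d + a * c * d + b * c * d
        = x * x * y + x * x * z + x * y * z + x * y * z ∧
      a * b * c * d = x * x * y * z + rootQuartic a b c d x ∧
      ∀ r, rootQuartic a b c d r = (r - x) ^ 2 * ((r - y) * (r - z)) + rootQuartic a b c d x := by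
  rw [(hasDerivAt_rootQuartic a b c d x).deriv] at hd
  -- Since `P'(x) = 0`, the quotient of `P - P(x)` by `(r - x)²` is a monic quadratic. It is `≤ 0`
  -- at `s`, so its roots `y, z` are real.
  have key : ∀ r, rootQuartic a b c d r = (r - x) ^ 2 * (r ^ 2 + (2 * x - (a + b + c + d)) * r
      + ((a * b + a * c + a * d + b * c + b * d + c * d) + 3 * x ^ 2
        - 2 * x * (a + b + c + d))) + rootQuartic a b c d x := by
    intro r
    simp only [rootQuartic]
    linear_combination (r - x) * hd
  have hpos : 0 < (s - x) ^ 2 := by have := sub_ne_zero.2 hs; positivity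
  have hq : s ^ 2 + (2 * x - (a + b + c + d)) * s
      + ((a * b + a * c + a * d + b * c + b * d + c * d) + 3 * x ^ 2
        - 2 * x * (a + b + c + d)) ≤ 0 := by
    by_contra! hc
    have := mul_pos hpos hc
    have := key s
    linarith
  obtain ⟨y, z, hβ, hγ⟩ := exists_roots_of_quadratic hq
  have e1 : a + b + c + d = x + x + y + z := by linarith
  have e2 : a * b + a * c + a * d + b * c + b * d + c * d
        = x * x + x * y + x * z + x * y + x * z + y * z := by
    linear_combination hγ + 2 * x * e1
  have e3 : a * b * c + a * b * d + a * c * d + b * c * d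
        = x * x * y + x * x * z + x * y * z + x * y * z := by
    linear_combination -hd - 3 * x ^ 2 * e1 + 2 * x * e2
  refine ⟨y, z, e1, e2, e3, ?_, fun r => ?_⟩
  · have := key 0
    simp only [rootQuartic] at this ⊢
    linear_combination this + x ^ 2 * hγ
  · rw [key r, hβ, hγ]
    ring

theorem exists_critical_points {a b c d : ℝ} (hab : a < b) (hbc : b < c) (hcd : c < d) :
    (∃ x ∈ Set.Ioo a b, deriv (rootQuartic a b c d) x = 0 ∧ rootQuartic a b c d x < 0) ∧
    (∃ x ∈ Set.Ioo b c, deriv (rootQuartic a b c d) x = 0 ∧ 0 < rootQuartic a b c d x) ∧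
    (∃ x ∈ Set.Ioo c d, deriv (rootQuartic a b c d) x = 0 ∧ rootQuartic a b c d x < 0) := by
  have hcont : ∀ s, ContinuousOn (rootQuartic a b c d) s := fun s x _ =>
    (hasDerivAt_rootQuartic a b c d x).continuousAt.continuousWithinAt
  refine ⟨?_, ?_, ?_⟩
  · obtain ⟨x, hx, hd⟩ := exists_deriv_eq_zero hab (hcont _)
      (by simp [rootQuartic] : rootQuartic a b c d a = rootQuartic a b c d b)
    refine ⟨x, hx, hd, ?_⟩
    have h1 : 0 < (x - a) * (b - x) := mul_pos (by linarith [hx.1]) (by linarith [hx.2])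
    have h2 : 0 < (c - x) * (d - x) := mul_pos (by linarith [hx.2]) (by linarith [hx.2])
    have := mul_pos h1 h2
    simp only [rootQuartic]
    nlinarith
  · obtain ⟨x, hx, hd⟩ := exists_deriv_eq_zero hbc (hcont _)
      (by simp [rootQuartic] : rootQuartic a b c d b = rootQuartic a b c d c)
    refine ⟨x, hx, hd, ?_⟩
    have h1 : 0 < (x - a) * (x - b) := mul_pos (by linarith [hx.1]) (by linarith [hx.1])
    have h2 : 0 < (c - x) * (d - x) := mul_pos (by linarith [hx.2]) (by linarith [hx.2])
    have := mul_pos h1 h2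
    simp only [rootQuartic]
    nlinarith
  · obtain ⟨x, hx, hd⟩ := exists_deriv_eq_zero hcd (hcont _)
      (by simp [rootQuartic] : rootQuartic a b c d c = rootQuartic a b c d d)
    refine ⟨x, hx, hd, ?_⟩
    have h1 : 0 < (x - a) * (x - b) := mul_pos (by linarith [hx.1]) (by linarith [hx.1])
    have h2 : 0 < (x - c) * (d - x) := mul_pos (by linarith [hx.1]) (by linarith [hx.2])
    have := mul_pos h1 h2
    simp only [rootQuartic]
    nlinarith

/-- Four distinct reals can be moved, with `e₁, e₂, e₃` fixed and `e₄` decreasing, to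
`x, x, y, z` with `y < x < z`. -/
theorem exists_double_of_lt_down {a b c d : ℝ} (hab : a < b) (hbc : b < c) (hcd : c < d) :
    ∃ x y z m : ℝ, y < x ∧ x < z ∧ 0 < m ∧ a + b + c + d = x + x + y + z ∧
      a * b + a * c + a * d + b * c + b * d + c * d
        = x * x + x * y + x * z + x * y + x * z + y * z ∧
      a * b * c + a * b * d + a * c * d + b * c * d
        = x * x * y + x * x * z + x * y * z + x * y * z ∧
      a * b * c * d = x * x * y * z + m := by
  obtain ⟨-, ⟨x, hx, hd, hm⟩, -⟩ := exists_critical_points hab hbc hcd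
  have hb0 : rootQuartic a b c d b = 0 := by simp [rootQuartic]
  have hc0 : rootQuartic a b c d c = 0 := by simp [rootQuartic]
  -- The root `b` can serve as the second point because `P(b) = 0 < P(x)`.
  obtain ⟨y, z, e1, e2, e3, e4, hr⟩ := exists_double_root (s := b) hd hx.1.ne
    (by rw [hb0]; exact hm.le)
  have hb := hr b
  have hc := hr c
  rw [hb0] at hb
  rw [hc0] at hc
  have hb' : (b - y) * (b - z) < 0 := by
    by_contra! h
    nlinarith [mul_nonneg (sq_nonneg (b - x)) h]
  have hc' : (c - y) * (c - z) < 0 := by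
    by_contra! h
    nlinarith [mul_nonneg (sq_nonneg (c - x)) h]
  -- The convex function `(r - y)(r - z)` is negative at `b` and `c`, hence at `x` between them. So
  -- `x` separates `y` and `z`.
  have hx' : (x - y) * (x - z) < 0 := by
    have h1 : 0 < (x - b) * (c - x) := mul_pos (by linarith [hx.1]) (by linarith [hx.2])
    have h2 : 0 < c - b := by linarith
    by_contra! h
    nlinarith [mul_nonneg h2.le h, mul_neg_of_pos_of_neg (sub_pos.2 hx.2) hb',
      mul_neg_of_pos_of_neg (sub_pos.2 hx.1) hc', mul_pos h2 h1]
  rcases mul_neg_iff.1 hx' with h | h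
  · exact ⟨x, y, z, _, by linarith, by linarith, hm, e1, e2, e3, e4⟩
  · refine ⟨x, z, y, _, by linarith, by linarith, hm, by linarith, by linarith, by linarith, ?_⟩
    rw [e4]; ring

/-- Four distinct reals can be moved, with `e₁, e₂, e₃` fixed and `e₄` increasing, to
`x, x, y, z`. -/
theorem exists_double_of_lt_up {a b c d : ℝ} (hab : a < b) (hbc : b < c) (hcd : c < d) :
    ∃ x y z m : ℝ, 0 < m ∧ a + b + c + d = x + x + y + z ∧
      a * b + a * c + a * d + b * c + b * d + c * d
        = x * x + x * y + x * z + x * y + x * z + y * z ∧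
      a * b * c + a * b * d + a * c * d + b * c * d
        = x * x * y + x * x * z + x * y * z + x * y * z ∧
      a * b * c * d = x * x * y * z - m := by
  obtain ⟨⟨x₁, hx₁, hd₁, hm₁⟩, -, ⟨x₂, hx₂, hd₂, hm₂⟩⟩ := exists_critical_points hab hbc hcd
  have hne : x₁ < x₂ := by linarith [hx₁.2, hx₂.1]
  -- Of the two negative critical values the higher one is used: after subtracting it, the other
  -- critical point still has a value `≤ 0`, which keeps all roots real.
  rcases le_total (rootQuartic a b c d x₁) (rootQuartic a b c d x₂) with h | h
  · obtain ⟨y, z, e1, e2, e3, e4, -⟩ := exists_double_root hd₂ hne.ne h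
    exact ⟨x₂, y, z, -rootQuartic a b c d x₂, by linarith, e1, e2, e3, by linarith⟩
  · obtain ⟨y, z, e1, e2, e3, e4, -⟩ := exists_double_root hd₁ hne.ne' h
    exact ⟨x₁, y, z, -rootQuartic a b c d x₁, by linarith, e1, e2, e3, by linarith⟩

/-! ### Sign and zeros of the quartic -/

theorem quarticFun_diag_nonneg {t w : ℝ} (h : 0 ≤ VF t w) (x y z : ℝ) :
    0 ≤ quarticFun t w x x y z := by
  rw [quarticFun_diag]
  positivity

theorem quarticFun_nonneg_of_lt {t w a b c d : ℝ} (h : 0 ≤ VF t w) (hab : a < b) (hbc : b < c)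
    (hcd : c < d) : 0 ≤ quarticFun t w a b c d := by
  obtain ⟨φ, ε, hφ⟩ := exists_quarticFun_eq_affine t w
  obtain ⟨x, y, z, m, -, -, hm, e1, e2, e3, e4⟩ := exists_double_of_lt_down hab hbc hcd
  obtain ⟨x', y', z', m', hm', e1', e2', e3', e4'⟩ := exists_double_of_lt_up hab hbc hcd
  have h1 := quarticFun_diag_nonneg h x y z
  have h2 := quarticFun_diag_nonneg h x' y' z'
  rw [hφ] at h1 h2 ⊢
  rw [← e1, ← e2, ← e3, ← sub_eq_iff_eq_add.2 e4] at h1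
  rw [← e1', ← e2', ← e3', ← eq_sub_iff_add_eq.1 e4'] at h2
  -- The sign of the slope `ε` decides which end of the `e₄`-interval bounds the value from below.
  rcases le_total 0 ε with hε | hε
  · nlinarith [mul_nonneg hε hm.le]
  · nlinarith [mul_nonneg (neg_nonneg.2 hε) hm'.le]

/-- Both squares of `quarticFun_diag` must vanish. If `y = z`, the first one reduces to the stated
quadratic. If `y + z = (t+1)x`, it reduces to a multiple of `(y - x)(y - tx)`. -/
theorem quarticFun_diag_eq_zero {t w x y z : ℝ} (ht : t ≠ 1) (h : 0 < VF t w)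
    (h0 : quarticFun t w x x y z = 0) :
    (y = z ∧ y ^ 2 - (w + 2) * y * x + x ^ 2 = 0) ∨ (y = x ∧ z = t * x) ∨ (y = t * x ∧ z = x) := by
  rw [quarticFun_diag] at h0
  have ht' : t - 1 ≠ 0 := sub_ne_zero.2 ht
  have hA := sq_nonneg ((2 * (t + 1) * w - (t - 1) ^ 2) * (y - z) ^ 2
        + (t - 1) ^ 2 * ((y + z) ^ 2 - 2 * (w + 2) * (y + z) * x + 4 * x ^ 2))
  have hB : 0 ≤ VF t w * (y - z) ^ 2 * (y + z - (t + 1) * x) ^ 2 := by positivity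
  have hA0 := pow_eq_zero_iff (two_ne_zero) |>.1 (le_antisymm (by linarith) hA)
  have hB0 : VF t w * (y - z) ^ 2 * (y + z - (t + 1) * x) ^ 2 = 0 := by linarith
  -- If this coefficient vanished, `V_F` would equal `-(w(t+3))² ≤ 0`.
  have hM : 2 * (t + 1) * w - (t - 1) ^ 2 ≠ 0 := by
    intro hM
    have : VF t w = -(w * (t + 3)) ^ 2 := by
      simp only [VF]
      linear_combination 6 * w * hM
    rw [this] at h
    linarith [sq_nonneg (w * (t + 3))]
  rcases mul_eq_zero.1 hB0 with hB1 | hB1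
  · have hyz : y = z := by
      rcases mul_eq_zero.1 hB1 with h' | h'
      · exact absurd h' h.ne'
      · exact sub_eq_zero.1 (pow_eq_zero_iff two_ne_zero |>.1 h')
    subst hyz
    refine Or.inl ⟨rfl, ?_⟩
    have : (t - 1) ^ 2 * (4 * (y ^ 2 - (w + 2) * y * x + x ^ 2)) = 0 := by
      linear_combination hA0
    have := (mul_eq_zero.1 this).resolve_left (pow_ne_zero 2 ht')
    linarith
  · have hp := pow_eq_zero_iff two_ne_zero |>.1 hB1
    have : (2 * (t + 1) * w - (t - 1) ^ 2) * (4 * ((y - x) * (y - t * x))) = 0 := by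
      obtain rfl : z = (t + 1) * x - y := by linarith
      linear_combination hA0
    have := (mul_eq_zero.1 ((mul_eq_zero.1 ((mul_eq_zero.1 this).resolve_left hM)).resolve_left
      four_ne_zero))
    rcases this with h' | h'
    · exact Or.inr (Or.inl ⟨by linarith, by linarith⟩)
    · exact Or.inr (Or.inr ⟨by linarith, by linarith⟩)

/-- The lower end of the `e₄`-interval is `(x,x,y,z)` with `y < x < z`, which matches none of the
zeros on the plane `a = b`. So the value there is positive, and positivity survives whatever the
sign of the slope. -/
theorem quarticFun_pos_of_lt {t w a b c d : ℝ} (ht : t ≠ 1) (h : 0 < VF t w) (hab : a < b)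
    (hbc : b < c) (hcd : c < d) : 0 < quarticFun t w a b c d := by
  obtain ⟨φ, ε, hφ⟩ := exists_quarticFun_eq_affine t w
  obtain ⟨x, y, z, m, hyx, hxz, hm, e1, e2, e3, e4⟩ := exists_double_of_lt_down hab hbc hcd
  obtain ⟨x', y', z', m', hm', e1', e2', e3', e4'⟩ := exists_double_of_lt_up hab hbc hcd
  have h1 : 0 < quarticFun t w x x y z := by
    refine lt_of_le_of_ne (quarticFun_diag_nonneg h.le x y z) fun h0 => ?_
    rcases quarticFun_diag_eq_zero ht h h0.symm with h' | h' | h'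
    · linarith [h'.1]
    · linarith [h'.1]
    · linarith [h'.2]
  have h2 := quarticFun_diag_nonneg h.le x' y' z'
  rw [hφ] at h1 h2 ⊢
  rw [← e1, ← e2, ← e3, ← sub_eq_iff_eq_add.2 e4] at h1
  rw [← e1', ← e2', ← e3', ← eq_sub_iff_add_eq.1 e4'] at h2
  rcases le_total 0 ε with hε | hε
  · nlinarith [mul_nonneg hε hm.le]
  · rcases hε.eq_or_lt with rfl | hε
    · linarith
    · nlinarith [mul_pos hm' (neg_pos.2 hε)]

/-! ### Symmetry and homogeneity -/

theorem S4_eq : S4 = psum (Fin 4) ℝ 4 := rfl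

theorem T31_eq : T31 = psum (Fin 4) ℝ 3 * psum (Fin 4) ℝ 1 - psum (Fin 4) ℝ 4 := by
  refine MvPolynomial.funext fun v => ?_
  rw [eval_T31]
  simp only [psum, Fin.sum_univ_four, map_add, map_sub, map_mul, map_pow, eval_X]
  ring

theorem S22_eq_psum :
    S22 = C (1 / 2) * (psum (Fin 4) ℝ 2 * psum (Fin 4) ℝ 2 - psum (Fin 4) ℝ 4) := by
  refine MvPolynomial.funext fun v => ?_
  rw [S22_eq]
  simp only [psum, Fin.sum_univ_four, map_add, map_sub, map_mul, map_pow, eval_X, eval_C]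
  ring

theorem T211_eq : T211 = C (1 / 2) * (psum (Fin 4) ℝ 2 * psum (Fin 4) ℝ 1 * psum (Fin 4) ℝ 1
    - psum (Fin 4) ℝ 2 * psum (Fin 4) ℝ 2 - 2 * (psum (Fin 4) ℝ 3 * psum (Fin 4) ℝ 1)
    + 2 * psum (Fin 4) ℝ 4) := by
  refine MvPolynomial.funext fun v => ?_
  rw [eval_T211]
  simp only [psum, Fin.sum_univ_four, map_add, map_sub, map_mul, map_pow, eval_X, eval_C,
    map_ofNat]
  ring

theorem U4_eq : U4 = ∏ i : Fin 4, X i := by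
  simp [U4, Fin.prod_univ_four]

theorem rename_psum_perm (σ : Equiv.Perm (Fin 4)) (n : ℕ) :
    rename σ (psum (Fin 4) ℝ n) = psum (Fin 4) ℝ n := psum_isSymmetric _ _ n σ

theorem rename_U4 (σ : Equiv.Perm (Fin 4)) : rename σ U4 = U4 := by
  simp only [U4_eq, map_prod, rename_X]
  exact Equiv.prod_comp σ (fun i => (X i : MvPolynomial (Fin 4) ℝ))

theorem isSymmetric_quartic (t u : ℝ) : (quartic t u).IsSymmetric := by
  intro σ
  simp only [quartic, s0, s1, s2, s3, s4, S4_eq, T31_eq, S22_eq_psum, T211_eq, map_add, map_sub,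
    map_mul, rename_psum_perm, rename_U4, rename_C, map_ofNat]

theorem isHomogeneous_ofNat (n : ℕ) [n.AtLeastTwo] :
    (OfNat.ofNat n : MvPolynomial (Fin 4) ℝ).IsHomogeneous 0 := by
  rw [← map_ofNat (C : ℝ →+* MvPolynomial (Fin 4) ℝ) n]
  exact isHomogeneous_C _ _

theorem psum_isHomogeneous' (n : ℕ) : (psum (Fin 4) ℝ n).IsHomogeneous n :=
  IsHomogeneous.sum _ _ _ fun i _ => by simpa using (isHomogeneous_X ℝ i).pow n

theorem U4_isHomogeneous : U4.IsHomogeneous 4 :=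
  (((isHomogeneous_X ℝ 0).mul (isHomogeneous_X ℝ 1)).mul (isHomogeneous_X ℝ 2)).mul
    (isHomogeneous_X ℝ 3)

theorem isHomogeneous_quartic (t u : ℝ) : (quartic t u).IsHomogeneous 4 := by
  have hps := psum_isHomogeneous'
  have h4 : S4.IsHomogeneous 4 := hps 4
  have h31 : T31.IsHomogeneous 4 := T31_eq ▸ ((hps 3).mul (hps 1)).sub (hps 4)
  have h22 : S22.IsHomogeneous 4 := S22_eq_psum ▸ (((hps 2).mul (hps 2)).sub (hps 4)).C_mul _
  have h211 : T211.IsHomogeneous 4 := by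
    rw [T211_eq]
    refine (IsHomogeneous.add (IsHomogeneous.sub (IsHomogeneous.sub
      (((hps 2).mul (hps 1)).mul (hps 1)) ((hps 2).mul (hps 2))) ?_) ?_).C_mul _
    · simpa using (isHomogeneous_ofNat 2).mul ((hps 3).mul (hps 1))
    · simpa using (isHomogeneous_ofNat 2).mul (hps 4)
  have hU := U4_isHomogeneous
  have hn : ∀ (n : ℕ) [n.AtLeastTwo],
      ((OfNat.ofNat n : MvPolynomial (Fin 4) ℝ) * U4).IsHomogeneous 4 := fun n _ => by
    simpa using (isHomogeneous_ofNat n).mul hU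
  exact (((((h4.sub (hn 4)).C_mul _).add ((h31.sub (hn 12)).C_mul _)).add
    ((h22.sub (hn 6)).C_mul _)).add ((h211.sub (hn 12)).C_mul _)).add (hU.C_mul _) |>.C_mul _

theorem quartic_mem_SymForms (t u : ℝ) : quartic t u ∈ SymForms 4 4 :=
  ⟨isHomogeneous_quartic t u, isSymmetric_quartic t u⟩

theorem eval_quartic_comp_perm (t u : ℝ) (v : Fin 4 → ℝ) (σ : Equiv.Perm (Fin 4)) :
    eval (v ∘ σ) (quartic t u) = eval v (quartic t u) := by
  rw [← eval_rename, isSymmetric_quartic t u σ]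

theorem exists_perm_of_ne {i j : Fin 4} (h : i ≠ j) :
    ∃ σ : Equiv.Perm (Fin 4), σ 0 = i ∧ σ 1 = j := by
  revert i j
  decide

/-! ### Nonnegativity -/

theorem omega_mul_self {u : ℝ} (hu : u ≠ 0) : omega u * u = (u - 1) ^ 2 := by
  simp only [omega]
  field_simp
  ring

theorem omega_ne_zero {u : ℝ} (hu : u ≠ 0) (hu1 : u ≠ 1) : omega u ≠ 0 := by
  intro h
  have := omega_mul_self hu
  rw [h, zero_mul] at this
  exact hu1 (sub_eq_zero.1 (pow_eq_zero_iff two_ne_zero |>.1 this.symm))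

/-- A point of `ℝ⁴` has, up to a permutation, two equal coordinates or strictly increasing ones. -/
theorem exists_perm_diag_or_lt (v : Fin 4 → ℝ) : ∃ σ : Equiv.Perm (Fin 4),
    v (σ 0) = v (σ 1) ∨ (v (σ 0) < v (σ 1) ∧ v (σ 1) < v (σ 2) ∧ v (σ 2) < v (σ 3)) := by
  by_cases hv : Function.Injective v
  · have hm : StrictMono (v ∘ Tuple.sort v) :=
      (Tuple.monotone_sort v).strictMono_of_injective (hv.comp (Tuple.sort v).injective)
    exact ⟨Tuple.sort v, Or.inr ⟨hm (by decide), hm (by decide), hm (by decide)⟩⟩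
  · simp only [Function.Injective, not_forall] at hv
    obtain ⟨i, j, hij, hne⟩ := hv
    obtain ⟨σ, rfl, rfl⟩ := exists_perm_of_ne hne
    exact ⟨σ, Or.inl hij⟩

theorem eval_quartic_perm (t u : ℝ) (v : Fin 4 → ℝ) (σ : Equiv.Perm (Fin 4)) :
    eval v (quartic t u)
      = u ^ 2 * quarticFun t (omega u) (v (σ 0)) (v (σ 1)) (v (σ 2)) (v (σ 3)) := by
  rw [← eval_quartic_comp_perm t u v σ, eval_quartic]
  rfl

theorem eval_quartic_nonneg {t u : ℝ} (h : 0 ≤ VF t (omega u)) (v : Fin 4 → ℝ) :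
    0 ≤ eval v (quartic t u) := by
  obtain ⟨σ, hσ⟩ := exists_perm_diag_or_lt v
  rw [eval_quartic_perm t u v σ]
  refine mul_nonneg (sq_nonneg u) ?_
  rcases hσ with h' | ⟨h1, h2, h3⟩
  · rw [h']
    exact quarticFun_diag_nonneg h _ _ _
  · exact quarticFun_nonneg_of_lt h h1 h2 h3

/-- At `(1, 1, y+e, y-e)` the quartic equals `2e²(M²e² + V_F k²)`, which is negative for small `e ≠
0`. The choice `e² = -V_F k²/(M²+1)` makes it `-2e⁴`; the `+1` covers `M = 0`. -/
theorem exists_quarticFun_neg {t w y : ℝ} (h : VF t w < 0) (hy : y ^ 2 - (w + 2) * y + 1 = 0)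
    (hyt : 2 * y ≠ t + 1) : ∃ e, quarticFun t w 1 1 (y + e) (y - e) < 0 := by
  set M := 2 * (t + 1) * w - (t - 1) ^ 2 with hM
  set k := 2 * y - (t + 1) with hk
  have hk0 : 0 < k ^ 2 := by
    have : k ≠ 0 := sub_ne_zero.2 hyt
    positivity
  have hr : 0 < -VF t w * k ^ 2 / (M ^ 2 + 1) := by
    have : 0 < -VF t w := by linarith
    positivity
  refine ⟨√(-VF t w * k ^ 2 / (M ^ 2 + 1)), ?_⟩
  set e := √(-VF t w * k ^ 2 / (M ^ 2 + 1)) with he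
  have he2 : e ^ 2 * (M ^ 2 + 1) = -VF t w * k ^ 2 := by
    rw [he, Real.sq_sqrt hr.le]
    field_simp
  have he0 : 0 < e ^ 2 := by
    rw [he, Real.sq_sqrt hr.le]
    exact hr
  have hval : quarticFun t w 1 1 (y + e) (y - e)
      = 2 * e ^ 2 * (e ^ 2 * (M ^ 2 + 1) + VF t w * k ^ 2) - 2 * (e ^ 2) ^ 2 := by
    rw [quarticFun_diag]
    linear_combination (4 * M * (t - 1) ^ 2 * e ^ 2
      + 2 * (t - 1) ^ 4 * (y ^ 2 - (w + 2) * y + 1)) * hy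
  rw [hval, he2]
  nlinarith [mul_pos he0 he0]

theorem quartic_mem_SymPSD_iff {t u : ℝ} (hu : u ≠ 0) (hu1 : u ≠ 1) :
    quartic t u ∈ SymPSD 4 4 ↔ 0 ≤ VF t (omega u) := by
  refine ⟨fun h => ?_, fun h => ⟨quartic_mem_SymForms t u, fun v _ => eval_quartic_nonneg h v⟩⟩
  by_contra! hV
  have hw := omega_mul_self hu
  -- The candidates are `u` and `1/u`. Both fail only if `u = -1` and `t = -3`, where `V_F = 0`.
  obtain ⟨y, hy, hyt⟩ : ∃ y, y ^ 2 - (omega u + 2) * y + 1 = 0 ∧ 2 * y ≠ t + 1 := by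
    by_cases h1 : 2 * u = t + 1
    · refine ⟨1 / u, ?_, fun h2 => ?_⟩
      · field_simp
        linear_combination -hw
      · have h3 : (u - 1) * (u + 1) = 0 := by
          have : 1 / u = u := by linarith
          field_simp at this
          linear_combination -this
        have h4 : u = -1 := by
          linarith [(mul_eq_zero.1 h3).resolve_left (sub_ne_zero.2 hu1)]
        subst h4
        obtain rfl : t = -3 := by linarith
        norm_num [VF, omega] at hV
    · exact ⟨u, by linear_combination -hw, h1⟩
  obtain ⟨e, he⟩ := exists_quarticFun_neg hV hy hyt
  have := h.2 ![1, 1, y + e, y - e] trivial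
  rw [eval_quartic] at this
  have h2 : 0 < u ^ 2 := by positivity
  exact absurd (nonneg_of_mul_nonneg_right this h2) (not_le.2 he)

theorem neg_quartic_notMem_SymPSD {t u : ℝ} (hu : u ≠ 0) (htu : (t, u) ≠ (1, 1)) :
    -quartic t u ∉ SymPSD 4 4 := by
  have key : ∃ a b c d, 0 < quarticFun t (omega u) a b c d := by
    by_cases hu1 : u = 1
    · subst hu1
      have ht : t - 1 ≠ 0 := sub_ne_zero.2 fun h => htu (by rw [h])
      refine ⟨1, 1, 0, 0, ?_⟩
      have : quarticFun t (omega 1) 1 1 0 0 = 2 * (t - 1) ^ 4 := by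
        simp only [quarticFun, p0, p1, p2, p3, p4, omega]
        ring
      rw [this]
      positivity
    · have hw := omega_ne_zero hu hu1
      by_cases ht : t = 1
      · subst ht
        refine ⟨1, 0, 0, 0, ?_⟩
        have : quarticFun 1 (omega u) 1 0 0 0 = 6 * omega u ^ 2 := by
          simp only [quarticFun, p0, p1, p2, p3, p4]
          ring
        rw [this]
        positivity
      · have ht : t - 1 ≠ 0 := sub_ne_zero.2 ht
        refine ⟨1, 1, 1, 1, ?_⟩
        have : quarticFun t (omega u) 1 1 1 1 = 2 * (t - 1) ^ 4 * omega u ^ 2 := by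
          simp only [quarticFun, p0, p1, p2, p3, p4]
          ring
        rw [this]
        positivity
  obtain ⟨a, b, c, d, hpos⟩ := key
  intro h
  have := h.2 ![a, b, c, d] trivial
  rw [map_neg, eval_quartic] at this
  have h2 : 0 < u ^ 2 := by positivity
  have h3 := mul_pos h2 hpos
  simp only [Matrix.cons_val] at this
  linarith

/-! ### The parameter set -/

/-- Multiplying `V_F(t, ω(u))` by `u² > 0` turns it into a polynomial, so every condition becomes a
strict inequality or a `≠` between continuous functions. -/
theorem isOpen_paramSet : IsOpen paramSet := by
  have : paramSet = {x : ℝ × ℝ | x.1 ≠ 0 ∧ x.1 ≠ 1 ∧ x.2 ≠ 0 ∧ x.2 ≠ 1 ∧ x.2 ≠ -1 ∧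
      2 * x.2 ≠ x.1 + 1 ∧ x.1 * x.2 + x.2 ≠ 2 ∧ DF x.1 x.2 ≠ 0 ∧
      0 < (3 + 6 * x.1 - x.1 ^ 2) * (x.2 - 1) ^ 4 - 6 * (x.1 - 1) ^ 2 * (x.2 * (x.2 - 1) ^ 2)} := by
    ext ⟨t, u⟩
    simp only [paramSet, Set.mem_ofPred_eq]
    refine and_congr_right fun _ => and_congr_right fun _ => and_congr_right fun hu =>
      and_congr_right fun _ => and_congr_right fun _ => and_congr_right fun _ =>
      and_congr_right fun _ => and_congr_right fun _ => ?_
    have : (3 + 6 * t - t ^ 2) * (u - 1) ^ 4 - 6 * (t - 1) ^ 2 * (u * (u - 1) ^ 2)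
        = u ^ 2 * VF t (omega u) := by
      rw [← omega_mul_self hu, show (u - 1) ^ 4 = ((u - 1) ^ 2) ^ 2 by ring,
        ← omega_mul_self hu, VF]
      ring
    rw [this]
    exact (mul_pos_iff_of_pos_left (by positivity)).symm
  rw [this]
  simp only [DF]
  refine IsOpen.and ?_ (IsOpen.and ?_ (IsOpen.and ?_ (IsOpen.and ?_ (IsOpen.and ?_ (IsOpen.and ?_
    (IsOpen.and ?_ (IsOpen.and ?_ ?_)))))))
  all_goals first
    | exact isOpen_ne_fun (by fun_prop) (by fun_prop)
    | exact isOpen_lt (by fun_prop) (by fun_prop)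

theorem paramSet_nonempty : paramSet.Nonempty := by
  refine ⟨(2, -2), ?_⟩
  norm_num [paramSet, DF, VF, omega]

/-! ### Real projective zeros -/

theorem weight_one_fin {n : ℕ} (d : Fin n →₀ ℕ) :
    Finsupp.weight (1 : Fin n → ℕ) d = ∑ i, d i := by
  simp [Finsupp.weight_apply, Finsupp.sum_fintype]

theorem eval_smul_of_isHomogeneous {R : Type*} [CommRing R] {n k : ℕ} {f : MvPolynomial (Fin n) R}
    (hf : f.IsHomogeneous k) (r : R) (v : Fin n → R) : eval (r • v) f = r ^ k * eval v f := by
  rw [eval_eq', eval_eq', Finset.mul_sum]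
  refine Finset.sum_congr rfl fun d hd => ?_
  have hk : ∑ i, d i = k := by rw [← weight_one_fin]; exact hf (mem_support_iff.1 hd)
  simp only [Pi.smul_apply, smul_eq_mul, mul_pow, Finset.prod_mul_distrib,
    Finset.prod_pow_eq_pow_sum, hk]
  ring

theorem mk_mem_realZeros_iff {n k : ℕ} {f : MvPolynomial (Fin n) ℝ} (hf : f.IsHomogeneous k)
    {v : Fin n → ℝ} (hv : v ≠ 0) :
    Projectivization.mk ℝ v hv ∈ realZeros f ↔ eval v f = 0 := by
  refine ⟨fun h => h v hv rfl, fun h v' hv' he => ?_⟩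
  obtain ⟨r, rfl⟩ := (Projectivization.mk_eq_mk_iff' ℝ _ _ hv' hv).1 he
  rw [eval_smul_of_isHomogeneous hf, h, mul_zero]

/-- The preimage of a point is closed, being cut out by the vanishing of 2×2 minors. This makes
finite zero sets discrete. -/
instance instT1SpaceRealProj (n : ℕ) : T1Space (RealProj n) := by
  refine ⟨fun p => ?_⟩
  induction p using Projectivization.ind with | h v₀ h₀ =>
  refine isClosed_coinduced.2 ?_
  have : (fun v : {v : Fin n → ℝ // v ≠ 0} => Projectivization.mk ℝ v.1 v.2) ⁻¹'
      {Projectivization.mk ℝ v₀ h₀} = ⋂ i, ⋂ j, {v | v.1 i * v₀ j = v.1 j * v₀ i} := by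
    ext ⟨v, hv⟩
    simp only [Set.mem_preimage, Set.mem_singleton_iff, Set.mem_iInter, Set.mem_ofPred_eq,
      Projectivization.mk_eq_mk_iff']
    constructor
    · rintro ⟨r, rfl⟩ i j
      simp only [Pi.smul_apply, smul_eq_mul]
      ring
    · intro h
      obtain ⟨j, hj⟩ := Function.ne_iff.1 h₀
      refine ⟨v j / v₀ j, funext fun i => ?_⟩
      simp only [Pi.zero_apply] at hj
      simp only [Pi.smul_apply, smul_eq_mul]
      rw [div_mul_eq_mul_div, div_eq_iff hj, h i j]
  rw [this]
  exact isClosed_iInter fun i => isClosed_iInter fun j =>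
    isClosed_eq (((continuous_apply i).comp continuous_subtype_val).mul continuous_const)
      (((continuous_apply j).comp continuous_subtype_val).mul continuous_const)

/-- The representative of a zero of the quartic: `t` (if `S` is a singleton) or `u` at the
coordinates in `S`, and `1` elsewhere. -/
def zeroVec (t u : ℝ) (S : Finset (Fin 4)) : Fin 4 → ℝ :=
  fun i => if i ∈ S then (if S.card = 1 then t else u) else 1

/-- The index set of the zeros of the quartic. -/
def zeroIndex : Finset (Finset (Fin 4)) := {S | S.card = 1 ∨ S.card = 2}

theorem mem_zeroIndex {S : Finset (Fin 4)} : S ∈ zeroIndex ↔ S.card = 1 ∨ S.card = 2 := by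
  simp [zeroIndex]

theorem zeroVec_ne_zero (t : ℝ) {u : ℝ} (hu : u ≠ 0) (S : Finset (Fin 4)) :
    zeroVec t u S ≠ 0 := by
  intro h
  by_cases hS : ∃ i, i ∉ S
  · obtain ⟨i, hi⟩ := hS
    simpa [zeroVec, hi] using congrFun h i
  · push Not at hS
    have hS' : S = Finset.univ := Finset.eq_univ_iff_forall.2 hS
    subst hS'
    exact hu (by simpa [zeroVec] using congrFun h 0)

theorem zeroVec_singleton_comp (t u : ℝ) (σ : Equiv.Perm (Fin 4)) :
    zeroVec t u {σ 0} ∘ σ = ![t, 1, 1, 1] := by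
  funext i
  fin_cases i <;> simp [zeroVec]

theorem zeroVec_pair_comp (t u : ℝ) (σ : Equiv.Perm (Fin 4)) :
    zeroVec t u {σ 0, σ 1} ∘ σ = ![u, u, 1, 1] := by
  have : ({σ 0, σ 1} : Finset (Fin 4)).card = 2 := Finset.card_pair (by simp)
  funext i
  fin_cases i <;> simp [zeroVec, this]

theorem quarticFun_triple (t w : ℝ) : quarticFun t w t 1 1 1 = 0 := by
  simp only [quarticFun, p0, p1, p2, p3, p4]
  ring

theorem quarticFun_pair {t w u : ℝ} (h : w * u = (u - 1) ^ 2) : quarticFun t w u u 1 1 = 0 := by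
  rw [quarticFun_diag]
  linear_combination 2 * (t - 1) ^ 4 * (1 - (w + 2) * u + u ^ 2) * (-h)

theorem eval_quartic_triple (t u : ℝ) : eval ![t, 1, 1, 1] (quartic t u) = 0 := by
  rw [eval_quartic]
  simp [quarticFun_triple]

theorem eval_quartic_pair (t : ℝ) {u : ℝ} (hu : u ≠ 0) :
    eval ![u, u, 1, 1] (quartic t u) = 0 := by
  rw [eval_quartic]
  simp [quarticFun_pair (omega_mul_self hu)]

theorem exists_perm_apply_zero (i : Fin 4) : ∃ σ : Equiv.Perm (Fin 4), σ 0 = i :=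
  ⟨Equiv.swap 0 i, by simp⟩

theorem eval_zeroVec (t : ℝ) {u : ℝ} (hu : u ≠ 0) {S : Finset (Fin 4)} (hS : S ∈ zeroIndex) :
    eval (zeroVec t u S) (quartic t u) = 0 := by
  rcases mem_zeroIndex.1 hS with h | h
  · obtain ⟨i, rfl⟩ := Finset.card_eq_one.1 h
    obtain ⟨σ, rfl⟩ := exists_perm_apply_zero i
    rw [← eval_quartic_comp_perm t u _ σ, zeroVec_singleton_comp, eval_quartic_triple]
  · obtain ⟨i, j, hij, rfl⟩ := Finset.card_eq_two.1 h
    obtain ⟨σ, rfl, rfl⟩ := exists_perm_of_ne hij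
    rw [← eval_quartic_comp_perm t u _ σ, zeroVec_pair_comp, eval_quartic_pair t hu]

theorem exists_zeroVec_of_eval_eq_zero {t u : ℝ} (ht : t ≠ 1) (hu : u ≠ 0)
    (hV : 0 < VF t (omega u)) {v : Fin 4 → ℝ} (h : eval v (quartic t u) = 0) :
    ∃ S ∈ zeroIndex, ∃ r : ℝ, v = r • zeroVec t u S := by
  obtain ⟨σ, hσ⟩ := exists_perm_diag_or_lt v
  rw [eval_quartic_perm t u v σ] at h
  replace h := (mul_eq_zero.1 h).resolve_left (pow_ne_zero 2 hu)
  rcases hσ with h' | ⟨h1, h2, h3⟩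
  swap
  · exact absurd h (quarticFun_pos_of_lt ht hV h1 h2 h3).ne'
  have hcard : ∀ i j : Fin 4, i ≠ j → ({σ i, σ j} : Finset (Fin 4)).card = 2 :=
    fun i j hij => Finset.card_pair (by simpa using hij)
  have hext : ∀ w : Fin 4 → ℝ, v (σ 0) = w (σ 0) → v (σ 1) = w (σ 1) → v (σ 2) = w (σ 2) →
      v (σ 3) = w (σ 3) → v = w := by
    intro w a b c d
    funext i
    obtain ⟨j, rfl⟩ := σ.surjective i
    fin_cases j <;> assumption
  rw [← h'] at h
  rcases quarticFun_diag_eq_zero ht hV h with ⟨hyz, hq⟩ | ⟨hy, hz⟩ | ⟨hy, hz⟩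
  · have : (v (σ 2) - u * v (σ 0)) * (u * v (σ 2) - v (σ 0)) = 0 := by
      have := omega_mul_self hu
      linear_combination u * hq + v (σ 2) * v (σ 0) * this
    rcases mul_eq_zero.1 this with h0 | h0
    · refine ⟨{σ 2, σ 3}, mem_zeroIndex.2 (Or.inr (hcard _ _ (by decide))), v (σ 0),
        hext _ ?_ ?_ ?_ ?_⟩ <;>
      simp [zeroVec, hcard] <;> linarith
    · refine ⟨{σ 0, σ 1}, mem_zeroIndex.2 (Or.inr (hcard _ _ (by decide))), v (σ 2),
        hext _ ?_ ?_ ?_ ?_⟩ <;>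
      simp [zeroVec, hcard] <;> linarith
  · refine ⟨{σ 3}, mem_zeroIndex.2 (Or.inl (Finset.card_singleton _)), v (σ 0),
      hext _ ?_ ?_ ?_ ?_⟩ <;>
    simp [zeroVec] <;> linarith
  · refine ⟨{σ 2}, mem_zeroIndex.2 (Or.inl (Finset.card_singleton _)), v (σ 0),
      hext _ ?_ ?_ ?_ ?_⟩ <;>
    simp [zeroVec] <;> linarith

/-- The projective point of `zeroVec t u S`. -/
def zeroPoint (t : ℝ) {u : ℝ} (hu : u ≠ 0) (S : Finset (Fin 4)) : RealProj 4 :=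
  Projectivization.mk ℝ (zeroVec t u S) (zeroVec_ne_zero t hu S)

theorem realZeros_quartic {t u : ℝ} (ht : t ≠ 1) (hu : u ≠ 0) (hV : 0 < VF t (omega u)) :
    realZeros (quartic t u) = zeroPoint t hu '' (zeroIndex : Set (Finset (Fin 4))) := by
  ext p
  induction p using Projectivization.ind with | h v hv =>
  rw [mk_mem_realZeros_iff (isHomogeneous_quartic t u), Set.mem_image]
  constructor
  · intro h
    obtain ⟨S, hS, r, hr⟩ := exists_zeroVec_of_eval_eq_zero ht hu hV h
    exact ⟨S, hS, ((Projectivization.mk_eq_mk_iff' ℝ _ _ _ _).2 ⟨r, hr.symm⟩).symm⟩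
  · rintro ⟨S, hS, h⟩
    rw [← mk_mem_realZeros_iff (isHomogeneous_quartic t u) hv, ← h, zeroPoint,
      mk_mem_realZeros_iff (isHomogeneous_quartic t u)]
    exact eval_zeroVec t hu hS

/-- The partition of the coordinates into equal values recovers `S` up to complement. Complementary
index sets both have two elements, and proportionality then forces `u² = 1`. -/
theorem zeroVec_smul_injOn {t u r : ℝ} (ht : t ≠ 1) (hu1 : u ≠ 1) (hu2 : u ≠ -1)
    {S T : Finset (Fin 4)} (hS : S ∈ zeroIndex) (hT : T ∈ zeroIndex)
    (h : r • zeroVec t u T = zeroVec t u S) : S = T := by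
  have hval : ∀ i, r * zeroVec t u T i = zeroVec t u S i := fun i => by
    simpa using congrFun h i
  have hr : r ≠ 0 := by
    rintro rfl
    obtain ⟨i, hi⟩ : ∃ i, i ∉ S := by
      by_contra! hc
      rw [Finset.eq_univ_iff_forall.2 hc] at hS
      simp [mem_zeroIndex] at hS
    simpa [zeroVec, hi] using hval i
  have hsep : ∀ (A : Finset (Fin 4)) (i j : Fin 4),
      zeroVec t u A i = zeroVec t u A j ↔ (i ∈ A ↔ j ∈ A) := by
    intro A i j
    have h1 : (if A.card = 1 then t else u) ≠ 1 := by split_ifs <;> assumption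
    by_cases hi : i ∈ A <;> by_cases hj : j ∈ A <;> simp [zeroVec, hi, hj, h1, h1.symm]
  have hST : ∀ i j, (i ∈ S ↔ j ∈ S) ↔ (i ∈ T ↔ j ∈ T) := by
    intro i j
    rw [← hsep, ← hsep, ← hval, ← hval, mul_right_inj' hr]
  by_cases h0 : (0 ∈ S ↔ 0 ∈ T)
  · ext j
    have := hST 0 j
    tauto
  · exfalso
    have hTS : T = Sᶜ := by
      ext j
      have := hST 0 j
      rw [Finset.mem_compl]
      tauto
    have hc := Finset.card_compl S
    rw [← hTS, Fintype.card_fin] at hc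
    rw [mem_zeroIndex] at hS hT
    have hS2 : S.card = 2 := by omega
    have hT2 : T.card = 2 := by omega
    obtain ⟨i, hi⟩ : S.Nonempty := Finset.card_pos.1 (by omega)
    obtain ⟨j, hj⟩ : T.Nonempty := Finset.card_pos.1 (by omega)
    have hi' : i ∉ T := by simpa [hTS] using hi
    have hj' : j ∉ S := by simpa [hTS] using hj
    have e1 := hval i
    have e2 := hval j
    simp only [zeroVec, hi, hi', hj, hj', hS2, hT2, if_true, if_false] at e1 e2
    norm_num at e1 e2
    have : (u - 1) * (u + 1) = 0 := by rw [e1] at e2; linear_combination e2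
    rcases mul_eq_zero.1 this with h' | h'
    · exact hu1 (by linarith)
    · exact hu2 (by linarith)

theorem zeroPoint_injOn {t u : ℝ} (ht : t ≠ 1) (hu : u ≠ 0) (hu1 : u ≠ 1) (hu2 : u ≠ -1) :
    Set.InjOn (zeroPoint t hu) (zeroIndex : Set (Finset (Fin 4))) := by
  intro S hS T hT h
  obtain ⟨r, hr⟩ := (Projectivization.mk_eq_mk_iff' ℝ _ _ _ _).1 h
  exact zeroVec_smul_injOn ht hu1 hu2 hS hT hr

theorem ncard_realZeros_quartic {t u : ℝ} (ht : t ≠ 1) (hu : u ≠ 0) (hu1 : u ≠ 1) (hu2 : u ≠ -1)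
    (hV : 0 < VF t (omega u)) : (realZeros (quartic t u)).ncard = 10 := by
  rw [realZeros_quartic ht hu hV, (zeroPoint_injOn ht hu hu1 hu2).ncard_image,
    Set.ncard_coe_finset]
  decide

theorem isDiscrete_realZeros_quartic {t u : ℝ} (ht : t ≠ 1) (hu : u ≠ 0)
    (hV : 0 < VF t (omega u)) : IsDiscrete (realZeros (quartic t u)) := by
  rw [realZeros_quartic ht hu hV]
  exact (zeroIndex.finite_toSet.image _).isDiscrete

/-! ### Coefficients of forms in four variables -/

/-- The coefficient of `a^i b^j c^k d^l`. -/
def coeff4 {R : Type*} [CommRing R] (G : MvPolynomial (Fin 4) R) (i j k l : ℕ) : R :=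
  coeff (Finsupp.equivFunOnFinite.symm ![i, j, k, l]) G

theorem eval_eq_sum_antidiagonalTuple {R : Type*} [CommRing R] {k n : ℕ}
    {G : MvPolynomial (Fin n) R} (hG : G.IsHomogeneous k) (x : Fin n → R) :
    eval x G = ∑ d ∈ Finset.Nat.antidiagonalTuple n k,
      coeff (Finsupp.equivFunOnFinite.symm d) G * ∏ i, x i ^ d i := by
  rw [eval_eq']
  refine Finset.sum_of_injOn (fun d => (d : Fin n → ℕ)) DFunLike.coe_injective.injOn ?_ ?_ ?_
  · intro d hd
    rw [SetLike.mem_coe, Finset.Nat.mem_antidiagonalTuple, ← weight_one_fin]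
    exact hG (mem_support_iff.1 hd)
  · intro d _ hd'
    have : coeff (Finsupp.equivFunOnFinite.symm d) G = 0 := by
      by_contra h
      exact hd' ⟨_, mem_support_iff.2 h, by simp⟩
    rw [this, zero_mul]
  · intro d _
    simp

theorem eval_quartic_form {G : MvPolynomial (Fin 4) ℝ} (hG : G.IsHomogeneous 4) (a b c d : ℝ) :
    eval ![a, b, c, d] G =
      coeff4 G 0 0 0 4 * (d ^ 4) + coeff4 G 0 0 1 3 * (c * d ^ 3) +
      coeff4 G 0 0 2 2 * (c ^ 2 * d ^ 2) + coeff4 G 0 0 3 1 * (c ^ 3 * d) +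
      coeff4 G 0 0 4 0 * (c ^ 4) + coeff4 G 0 1 0 3 * (b * d ^ 3) +
      coeff4 G 0 1 1 2 * (b * c * d ^ 2) + coeff4 G 0 1 2 1 * (b * c ^ 2 * d) +
      coeff4 G 0 1 3 0 * (b * c ^ 3) + coeff4 G 0 2 0 2 * (b ^ 2 * d ^ 2) +
      coeff4 G 0 2 1 1 * (b ^ 2 * c * d) + coeff4 G 0 2 2 0 * (b ^ 2 * c ^ 2) +
      coeff4 G 0 3 0 1 * (b ^ 3 * d) + coeff4 G 0 3 1 0 * (b ^ 3 * c) +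
      coeff4 G 0 4 0 0 * (b ^ 4) + coeff4 G 1 0 0 3 * (a * d ^ 3) +
      coeff4 G 1 0 1 2 * (a * c * d ^ 2) + coeff4 G 1 0 2 1 * (a * c ^ 2 * d) +
      coeff4 G 1 0 3 0 * (a * c ^ 3) + coeff4 G 1 1 0 2 * (a * b * d ^ 2) +
      coeff4 G 1 1 1 1 * (a * b * c * d) + coeff4 G 1 1 2 0 * (a * b * c ^ 2) +
      coeff4 G 1 2 0 1 * (a * b ^ 2 * d) + coeff4 G 1 2 1 0 * (a * b ^ 2 * c) +
      coeff4 G 1 3 0 0 * (a * b ^ 3) + coeff4 G 2 0 0 2 * (a ^ 2 * d ^ 2) +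
      coeff4 G 2 0 1 1 * (a ^ 2 * c * d) + coeff4 G 2 0 2 0 * (a ^ 2 * c ^ 2) +
      coeff4 G 2 1 0 1 * (a ^ 2 * b * d) + coeff4 G 2 1 1 0 * (a ^ 2 * b * c) +
      coeff4 G 2 2 0 0 * (a ^ 2 * b ^ 2) + coeff4 G 3 0 0 1 * (a ^ 3 * d) +
      coeff4 G 3 0 1 0 * (a ^ 3 * c) + coeff4 G 3 1 0 0 * (a ^ 3 * b) + coeff4 G 4 0 0 0 * (a ^ 4) := by
  have hl : List.Nat.antidiagonalTuple 4 4 = [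
      ![0, 0, 0, 4], ![0, 0, 1, 3], ![0, 0, 2, 2], ![0, 0, 3, 1], ![0, 0, 4, 0], ![0, 1, 0, 3],
      ![0, 1, 1, 2], ![0, 1, 2, 1], ![0, 1, 3, 0], ![0, 2, 0, 2], ![0, 2, 1, 1], ![0, 2, 2, 0],
      ![0, 3, 0, 1], ![0, 3, 1, 0], ![0, 4, 0, 0], ![1, 0, 0, 3], ![1, 0, 1, 2], ![1, 0, 2, 1],
      ![1, 0, 3, 0], ![1, 1, 0, 2], ![1, 1, 1, 1], ![1, 1, 2, 0], ![1, 2, 0, 1], ![1, 2, 1, 0],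
      ![1, 3, 0, 0], ![2, 0, 0, 2], ![2, 0, 1, 1], ![2, 0, 2, 0], ![2, 1, 0, 1], ![2, 1, 1, 0],
      ![2, 2, 0, 0], ![3, 0, 0, 1], ![3, 0, 1, 0], ![3, 1, 0, 0], ![4, 0, 0, 0]] := by
    decide
  have hv : (Finset.Nat.antidiagonalTuple 4 4).val = List.Nat.antidiagonalTuple 4 4 := rfl
  rw [eval_eq_sum_antidiagonalTuple hG, Finset.sum_eq_multiset_sum, hv, hl, Multiset.map_coe,
    Multiset.sum_coe]
  simp only [List.map_cons, List.map_nil, List.sum_cons, List.sum_nil, Fin.prod_univ_four, coeff4,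
    Matrix.cons_val]
  ring

theorem eval_rename_swap01 (G : MvPolynomial (Fin 4) ℝ) (a b c d : ℝ) :
    eval ![a, b, c, d] (rename (Equiv.swap (0 : Fin 4) 1) G) = eval ![b, a, c, d] G := by
  rw [eval_rename]
  congr 2
  funext i
  fin_cases i <;> rfl

theorem eval_rename_swap23 (G : MvPolynomial (Fin 4) ℝ) (a b c d : ℝ) :
    eval ![a, b, c, d] (rename (Equiv.swap (2 : Fin 4) 3) G) = eval ![a, b, d, c] G := by
  rw [eval_rename]
  congr 2
  funext i
  fin_cases i <;> rfl

theorem mvPolynomial_ext4 {G H : MvPolynomial (Fin 4) ℝ}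
    (h : ∀ a b c d, eval ![a, b, c, d] G = eval ![a, b, c, d] H) : G = H := by
  refine MvPolynomial.funext fun v => ?_
  have hv : v = ![v 0, v 1, v 2, v 3] := by
    funext i
    fin_cases i <;> rfl
  rw [hv]
  exact h _ _ _ _

/-- Quartic forms antisymmetric in `a, b` and in `c, d`. -/
theorem exists_eq_of_antisymm_antisymm {G : MvPolynomial (Fin 4) ℝ} (hG : G.IsHomogeneous 4)
    (h01 : rename (Equiv.swap (0 : Fin 4) 1) G = -G)
    (h23 : rename (Equiv.swap (2 : Fin 4) 3) G = -G) :
    ∃ α β γ δ ε : ℝ, G = ((X 0 - X 1) * (X 2 - X 3)) *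
      (C α * (X 0 ^ 2 + X 1 ^ 2) + C β * (X 0 * X 1) + C γ * (X 2 ^ 2 + X 3 ^ 2)
        + C δ * (X 2 * X 3) + C ε * ((X 0 + X 1) * (X 2 + X 3))) := by
  -- The unknowns are read off from the coefficients of `a³c`, `a²bc`, `ac³`, `ac²d`, `a²c²`, each
  -- averaged with signs over its orbit under the two swaps.
  refine ⟨
    ((coeff4 G 3 0 1 0 - coeff4 G 0 3 1 0 - coeff4 G 3 0 0 1 + coeff4 G 0 3 0 1) / 4),
    ((coeff4 G 3 0 1 0 - coeff4 G 0 3 1 0 - coeff4 G 3 0 0 1 + coeff4 G 0 3 0 1) / 4)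
      + ((coeff4 G 2 1 1 0 - coeff4 G 1 2 1 0 - coeff4 G 2 1 0 1 + coeff4 G 1 2 0 1) / 4),
    ((coeff4 G 1 0 3 0 - coeff4 G 0 1 3 0 - coeff4 G 1 0 0 3 + coeff4 G 0 1 0 3) / 4),
    ((coeff4 G 1 0 3 0 - coeff4 G 0 1 3 0 - coeff4 G 1 0 0 3 + coeff4 G 0 1 0 3) / 4)
      + ((coeff4 G 1 0 2 1 - coeff4 G 0 1 2 1 - coeff4 G 1 0 1 2 + coeff4 G 0 1 1 2) / 4),
    ((coeff4 G 2 0 2 0 - coeff4 G 0 2 2 0 - coeff4 G 2 0 0 2 + coeff4 G 0 2 0 2) / 4), mvPolynomial_ext4 fun a b c d => ?_⟩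
  have e1 := fun a b c d => (eval_rename_swap01 G a b c d).symm.trans (by rw [h01, map_neg])
  have e2 := fun a b c d => (eval_rename_swap23 G a b c d).symm.trans (by rw [h23, map_neg])
  -- `G` equals its signed average over the group generated by the two swaps, so only averaged
  -- coefficients occur and the identity becomes formal.
  have e3 : eval ![a, b, c, d] G = (eval ![a, b, c, d] G - eval ![b, a, c, d] G
      - eval ![a, b, d, c] G + eval ![b, a, d, c] G) / 4 := by
    rw [e1 a b d c, e1 a b c d, e2 a b c d]
    ring
  rw [e3]
  simp only [eval_quartic_form hG, map_add, map_sub, map_mul, map_pow, eval_X, eval_C,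
    Matrix.cons_val]
  ring

/-- Quartic forms antisymmetric in `a, b` and symmetric in `c, d`. -/
theorem exists_eq_of_antisymm_symm {G : MvPolynomial (Fin 4) ℝ} (hG : G.IsHomogeneous 4)
    (h01 : rename (Equiv.swap (0 : Fin 4) 1) G = -G)
    (h23 : rename (Equiv.swap (2 : Fin 4) 3) G = G) :
    ∃ α β γ δ ε ζ η θ : ℝ, G = (X 0 - X 1) *
      (C α * (X 0 + X 1) ^ 3 + C β * ((X 0 + X 1) * (X 0 * X 1))
        + C γ * ((X 0 + X 1) ^ 2 * (X 2 + X 3)) + C δ * ((X 0 * X 1) * (X 2 + X 3))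
        + C ε * ((X 0 + X 1) * (X 2 + X 3) ^ 2) + C ζ * ((X 0 + X 1) * (X 2 * X 3))
        + C η * (X 2 + X 3) ^ 3 + C θ * ((X 2 + X 3) * (X 2 * X 3))) := by
  refine ⟨
    ((coeff4 G 4 0 0 0 - coeff4 G 0 4 0 0) / 2),
    ((coeff4 G 3 1 0 0 - coeff4 G 1 3 0 0) / 2)
      - 2 * ((coeff4 G 4 0 0 0 - coeff4 G 0 4 0 0) / 2),
    ((coeff4 G 3 0 1 0 - coeff4 G 0 3 1 0 + coeff4 G 3 0 0 1 - coeff4 G 0 3 0 1) / 4),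
    ((coeff4 G 2 1 1 0 - coeff4 G 1 2 1 0 + coeff4 G 2 1 0 1 - coeff4 G 1 2 0 1) / 4)
      - ((coeff4 G 3 0 1 0 - coeff4 G 0 3 1 0 + coeff4 G 3 0 0 1 - coeff4 G 0 3 0 1) / 4),
    ((coeff4 G 2 0 2 0 - coeff4 G 0 2 2 0 + coeff4 G 2 0 0 2 - coeff4 G 0 2 0 2) / 4),
    ((coeff4 G 2 0 1 1 - coeff4 G 0 2 1 1) / 2)
      - 2 * ((coeff4 G 2 0 2 0 - coeff4 G 0 2 2 0 + coeff4 G 2 0 0 2 - coeff4 G 0 2 0 2) / 4),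
    ((coeff4 G 1 0 3 0 - coeff4 G 0 1 3 0 + coeff4 G 1 0 0 3 - coeff4 G 0 1 0 3) / 4),
    ((coeff4 G 1 0 2 1 - coeff4 G 0 1 2 1 + coeff4 G 1 0 1 2 - coeff4 G 0 1 1 2) / 4)
      - 3 * ((coeff4 G 1 0 3 0 - coeff4 G 0 1 3 0 + coeff4 G 1 0 0 3 - coeff4 G 0 1 0 3) / 4), mvPolynomial_ext4 fun a b c d => ?_⟩
  have e1 := fun a b c d => (eval_rename_swap01 G a b c d).symm.trans (by rw [h01, map_neg])
  have e2 := fun a b c d => (eval_rename_swap23 G a b c d).symm.trans (by rw [h23])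
  have e3 : eval ![a, b, c, d] G = (eval ![a, b, c, d] G - eval ![b, a, c, d] G
      + eval ![a, b, d, c] G - eval ![b, a, d, c] G) / 4 := by
    rw [e1 a b d c, e1 a b c d, e2 a b c d]
    ring
  rw [e3]
  simp only [eval_quartic_form hG, map_add, map_sub, map_mul, map_pow, eval_X, eval_C,
    Matrix.cons_val]
  ring

theorem coeff4_of_rename {G : MvPolynomial (Fin 4) ℝ} {σ : Equiv.Perm (Fin 4)}
    (h : rename σ G = G) {m n : Fin 4 → ℕ} (hmn : ∀ i, m (σ i) = n i) :
    coeff (Finsupp.equivFunOnFinite.symm m) G = coeff (Finsupp.equivFunOnFinite.symm n) G := by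
  rw [← coeff_rename_mapDomain σ σ.injective G (Finsupp.equivFunOnFinite.symm n), h]
  congr 1
  ext i
  obtain ⟨j, rfl⟩ := σ.surjective i
  rw [Finsupp.mapDomain_apply σ.injective]
  exact hmn j

/-- Symmetric quartic forms. -/
theorem exists_eq_of_symm {G : MvPolynomial (Fin 4) ℝ} (hG : G.IsHomogeneous 4)
    (h : ∀ i j : Fin 4, i ≠ j → rename (Equiv.swap i j) G = G) :
    ∃ x₀ x₁ x₂ x₃ x₄ : ℝ,
      G = C x₀ * s0 + C x₁ * s1 + C x₂ * s2 + C x₃ * s3 + C x₄ * s4 := by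
  have h01 : ∀ i j k l, coeff4 G i j k l = coeff4 G j i k l := fun i j k l =>
    coeff4_of_rename (h 0 1 (by decide)) (fun r => by fin_cases r <;> rfl)
  have h12 : ∀ i j k l, coeff4 G i j k l = coeff4 G i k j l := fun i j k l =>
    coeff4_of_rename (h 1 2 (by decide)) (fun r => by fin_cases r <;> rfl)
  have h23 : ∀ i j k l, coeff4 G i j k l = coeff4 G i j l k := fun i j k l =>
    coeff4_of_rename (h 2 3 (by decide)) (fun r => by fin_cases r <;> rfl)
  -- The last coordinate is `G(1,1,1,1)`: the forms `s0`, …, `s3` vanish there and `s4` is 1.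
  refine ⟨coeff4 G 0 0 0 4, coeff4 G 0 0 1 3, coeff4 G 0 0 2 2, coeff4 G 0 1 1 2,
    coeff4 G 1 1 1 1 + 4 * coeff4 G 0 0 0 4 + 12 * coeff4 G 0 0 1 3 + 6 * coeff4 G 0 0 2 2
      + 12 * coeff4 G 0 1 1 2, mvPolynomial_ext4 fun a b c d => ?_⟩
  rw [eval_quartic_form hG]
  simp only [s0, s1, s2, s3, s4, U4, S22_eq, map_add, map_sub, map_mul, map_pow, eval_C,
    eval_S4, eval_T31, eval_T211, eval_X, map_ofNat, Matrix.cons_val]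
  rw [h01 4 0 0 0, h01 3 1 0 0, h01 3 0 1 0, h01 3 0 0 1, h12 2 2 0 0, h01 2 1 1 0, h01 2 1 0 1,
    h01 2 0 2 0, h01 2 0 1 1, h01 2 0 0 2, h12 1 3 0 0, h12 1 2 1 0, h12 1 2 0 1, h23 1 1 2 0,
    h12 1 1 0 2, h01 1 0 3 0, h01 1 0 2 1, h01 1 0 1 2, h01 1 0 0 3, h12 0 4 0 0, h12 0 3 1 0,
    h12 0 3 0 1, h23 0 2 2 0, h12 0 2 1 1, h12 0 2 0 2, h23 0 1 3 0, h23 0 1 2 1, h12 0 1 0 3,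
    h23 0 0 4 0, h23 0 0 3 1]
  ring

/-! ### Double zeros -/

/-- The derivative of `G` at `z` in the direction `v`. -/
def dirDeriv (z v : Fin 4 → ℝ) (G : MvPolynomial (Fin 4) ℝ) : ℝ :=
  (Polynomial.derivative (aeval (fun i => Polynomial.C (z i) + Polynomial.C (v i) * Polynomial.X)
    G)).eval 0

theorem eval_aeval_line (z v : Fin 4 → ℝ) (G : MvPolynomial (Fin 4) ℝ) (s : ℝ) :
    (aeval (fun i => Polynomial.C (z i) + Polynomial.C (v i) * Polynomial.X) G).eval s
      = eval (fun i => z i + v i * s) G := by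
  have h := MvPolynomial.map_aeval
    (fun i => Polynomial.C (z i) + Polynomial.C (v i) * Polynomial.X) (Polynomial.evalRingHom s) G
  rw [Polynomial.coe_evalRingHom] at h
  rw [h, MvPolynomial.eval, coe_eval₂Hom, coe_eval₂Hom]
  congr 1
  · ext; simp
  · funext i; simp

theorem eval_aeval_line_zero (z v : Fin 4 → ℝ) (G : MvPolynomial (Fin 4) ℝ) :
    (aeval (fun i => Polynomial.C (z i) + Polynomial.C (v i) * Polynomial.X) G).eval 0
      = eval z G := by
  simp [eval_aeval_line]

theorem dirDeriv_add (z v : Fin 4 → ℝ) (G H : MvPolynomial (Fin 4) ℝ) :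
    dirDeriv z v (G + H) = dirDeriv z v G + dirDeriv z v H := by
  simp [dirDeriv]

theorem dirDeriv_sub (z v : Fin 4 → ℝ) (G H : MvPolynomial (Fin 4) ℝ) :
    dirDeriv z v (G - H) = dirDeriv z v G - dirDeriv z v H := by
  simp [dirDeriv]

theorem dirDeriv_mul (z v : Fin 4 → ℝ) (G H : MvPolynomial (Fin 4) ℝ) :
    dirDeriv z v (G * H) = dirDeriv z v G * eval z H + eval z G * dirDeriv z v H := by
  simp only [dirDeriv, map_mul, Polynomial.derivative_mul, Polynomial.eval_add,
    Polynomial.eval_mul, eval_aeval_line_zero]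

theorem dirDeriv_C (z v : Fin 4 → ℝ) (r : ℝ) : dirDeriv z v (C r) = 0 := by
  simp [dirDeriv]

theorem dirDeriv_ofNat (z v : Fin 4 → ℝ) (n : ℕ) [n.AtLeastTwo] :
    dirDeriv z v ofNat(n) = 0 := by
  rw [← map_ofNat (C : ℝ →+* MvPolynomial (Fin 4) ℝ) n, dirDeriv_C]

theorem dirDeriv_smul (z v : Fin 4 → ℝ) (r : ℝ) (G : MvPolynomial (Fin 4) ℝ) :
    dirDeriv z v (r • G) = r * dirDeriv z v G := by
  simp [dirDeriv]

theorem dirDeriv_X (z v : Fin 4 → ℝ) (i : Fin 4) : dirDeriv z v (X i) = v i := by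
  simp [dirDeriv]

theorem dirDeriv_X_pow (z v : Fin 4 → ℝ) (i : Fin 4) (n : ℕ) :
    dirDeriv z v (X i ^ n) = n * z i ^ (n - 1) * v i := by
  simp [dirDeriv, Polynomial.derivative_pow]

theorem dirDeriv_rename (z v : Fin 4 → ℝ) (σ : Fin 4 → Fin 4) (G : MvPolynomial (Fin 4) ℝ) :
    dirDeriv z v (rename σ G) = dirDeriv (z ∘ σ) (v ∘ σ) G := by
  simp only [dirDeriv, aeval_rename]
  rfl

/-- `G` vanishes at `z` together with its first derivatives. -/
def IsDoubleZero (z : Fin 4 → ℝ) (G : MvPolynomial (Fin 4) ℝ) : Prop :=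
  eval z G = 0 ∧ ∀ v, dirDeriv z v G = 0

/-- A zero of a nonnegative form is a minimum along every line through it. -/
theorem isDoubleZero_of_nonneg {z : Fin 4 → ℝ} {G : MvPolynomial (Fin 4) ℝ}
    (h : ∀ x, 0 ≤ eval x G) (hz : eval z G = 0) : IsDoubleZero z G := by
  refine ⟨hz, fun v => ?_⟩
  refine IsLocalMin.hasDerivAt_eq_zero (Filter.Eventually.of_forall fun s => ?_)
    (Polynomial.hasDerivAt _ (0 : ℝ))
  rw [eval_aeval_line_zero, hz, eval_aeval_line]
  exact h _

theorem IsDoubleZero.of_mul {z : Fin 4 → ℝ} {G H : MvPolynomial (Fin 4) ℝ}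
    (h : IsDoubleZero z (G * H)) (hG : eval z G ≠ 0) : IsDoubleZero z H := by
  have h0 : eval z H = 0 := (mul_eq_zero.1 ((map_mul _ _ _).symm.trans h.1)).resolve_left hG
  refine ⟨h0, fun v => ?_⟩
  have := h.2 v
  rw [dirDeriv_mul, h0, mul_zero, zero_add] at this
  exact (mul_eq_zero.1 this).resolve_left hG

theorem IsDoubleZero.eval_eq_zero {z v : Fin 4 → ℝ} {G H : MvPolynomial (Fin 4) ℝ}
    (h : IsDoubleZero z (G * H)) (hG : eval z G = 0) (hv : dirDeriv z v G ≠ 0) :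
    eval z H = 0 := by
  have := h.2 v
  rw [dirDeriv_mul, hG, zero_mul, add_zero] at this
  exact (mul_eq_zero.1 this).resolve_left hv

/-- The quartic forms with double zeros at all permutations of `(t,1,1,1)` and `(u,u,1,1)`. -/
def doubleZeroForms (t u : ℝ) : Submodule ℝ (MvPolynomial (Fin 4) ℝ) where
  carrier := {G | G.IsHomogeneous 4 ∧ ∀ σ : Equiv.Perm (Fin 4),
    IsDoubleZero (![t, 1, 1, 1] ∘ σ) G ∧ IsDoubleZero (![u, u, 1, 1] ∘ σ) G}
  add_mem' := fun {G H} hG hH => ⟨hG.1.add hH.1, fun σ =>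
    ⟨⟨by rw [map_add, (hG.2 σ).1.1, (hH.2 σ).1.1, add_zero],
      fun v => by rw [dirDeriv_add, (hG.2 σ).1.2, (hH.2 σ).1.2, add_zero]⟩,
    ⟨by rw [map_add, (hG.2 σ).2.1, (hH.2 σ).2.1, add_zero],
      fun v => by rw [dirDeriv_add, (hG.2 σ).2.2, (hH.2 σ).2.2, add_zero]⟩⟩⟩
  zero_mem' := ⟨isHomogeneous_zero _ _ _, fun σ =>
    ⟨⟨by simp, fun v => by simp [dirDeriv]⟩, ⟨by simp, fun v => by simp [dirDeriv]⟩⟩⟩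
  smul_mem' := fun r G hG => ⟨by rw [smul_eq_C_mul]; exact hG.1.C_mul r, fun σ =>
    ⟨⟨by rw [smul_eval, (hG.2 σ).1.1, mul_zero],
      fun v => by rw [dirDeriv_smul, (hG.2 σ).1.2, mul_zero]⟩,
    ⟨by rw [smul_eval, (hG.2 σ).2.1, mul_zero],
      fun v => by rw [dirDeriv_smul, (hG.2 σ).2.2, mul_zero]⟩⟩⟩

/-! ### Forms with double zeros at all permutations of `(t,1,1,1)` and `(u,u,1,1)` -/

theorem rename_mem_doubleZeroForms {t u : ℝ} {G : MvPolynomial (Fin 4) ℝ}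
    (hG : G ∈ doubleZeroForms t u) (τ : Equiv.Perm (Fin 4)) :
    rename τ G ∈ doubleZeroForms t u := by
  refine ⟨hG.1.rename_isHomogeneous, fun σ => ⟨⟨?_, fun v => ?_⟩, ⟨?_, fun v => ?_⟩⟩⟩
  · rw [eval_rename]; exact (hG.2 (σ * τ)).1.1
  · rw [dirDeriv_rename]; exact (hG.2 (σ * τ)).1.2 _
  · rw [eval_rename]; exact (hG.2 (σ * τ)).2.1
  · rw [dirDeriv_rename]; exact (hG.2 (σ * τ)).2.2 _

theorem doubleZeroForms.pair {t u : ℝ} {G : MvPolynomial (Fin 4) ℝ}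
    (hG : G ∈ doubleZeroForms t u) : IsDoubleZero ![u, u, 1, 1] G := (hG.2 1).2

theorem doubleZeroForms.triple {t u : ℝ} {G : MvPolynomial (Fin 4) ℝ}
    (hG : G ∈ doubleZeroForms t u) : IsDoubleZero ![t, 1, 1, 1] G := (hG.2 1).1

theorem doubleZeroForms.pair' {t u : ℝ} {G : MvPolynomial (Fin 4) ℝ}
    (hG : G ∈ doubleZeroForms t u) : IsDoubleZero ![u, 1, u, 1] G := by
  have : (![u, u, 1, 1] : Fin 4 → ℝ) ∘ Equiv.swap (1 : Fin 4) 2 = ![u, 1, u, 1] := by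
    funext i
    fin_cases i <;> rfl
  exact this ▸ (hG.2 (Equiv.swap 1 2)).2

theorem doubleZeroForms.triple' {t u : ℝ} {G : MvPolynomial (Fin 4) ℝ}
    (hG : G ∈ doubleZeroForms t u) : IsDoubleZero ![1, 1, t, 1] G := by
  have : (![t, 1, 1, 1] : Fin 4 → ℝ) ∘ Equiv.swap (0 : Fin 4) 2 = ![1, 1, t, 1] := by
    funext i
    fin_cases i <;> rfl
  exact this ▸ (hG.2 (Equiv.swap 0 2)).1

/-- Write `G = (a-b)(c-d)K`. At `(u,1,u,1)` neither linear factor vanishes, so `K` has a double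
zero. At `(t,1,1,1)` only `c-d` vanishes, and simply, so `K` is zero there. -/
theorem eq_zero_of_antisymm_antisymm {t u : ℝ} (ht : t ≠ 1) (hu1 : u ≠ 1) (hu2 : u ≠ -1)
    {G : MvPolynomial (Fin 4) ℝ} (hG : G ∈ doubleZeroForms t u)
    (h01 : rename (Equiv.swap (0 : Fin 4) 1) G = -G)
    (h23 : rename (Equiv.swap (2 : Fin 4) 3) G = -G) : G = 0 := by
  obtain ⟨α, β, γ, δ, ε, rfl⟩ := exists_eq_of_antisymm_antisymm hG.1 h01 h23
  have ht' : t - 1 ≠ 0 := sub_ne_zero.2 ht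
  have hu' : u - 1 ≠ 0 := sub_ne_zero.2 hu1
  have hu2' : u + 1 ≠ 0 := fun h => hu2 (by linarith)
  have hp := (doubleZeroForms.pair' hG).of_mul (by simp [hu'])
  have ht0 := (doubleZeroForms.triple hG).eval_eq_zero (v := ![0, 0, 1, 0]) (by simp)
    (by simp [dirDeriv_mul, dirDeriv_sub, dirDeriv_X, ht'])
  have d0 := hp.2 ![1, 0, 0, 0]
  have d1 := hp.2 ![0, 1, 0, 0]
  have d2 := hp.2 ![0, 0, 1, 0]
  have d3 := hp.2 ![0, 0, 0, 1]
  simp only [dirDeriv_add, dirDeriv_mul, dirDeriv_C, dirDeriv_X, dirDeriv_X_pow, map_add, map_mul,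
    map_pow, eval_X, eval_C, Matrix.cons_val] at d0 d1 d2 d3 ht0
  norm_num at d0 d1 d2 d3 ht0
  have hβ : β = 2 * α := by
    refine sub_eq_zero.1 (mul_left_cancel₀ hu' ?_)
    linear_combination d1 - d0
  have hδ : δ = 2 * γ := by
    refine sub_eq_zero.1 (mul_left_cancel₀ hu' ?_)
    linear_combination d3 - d2
  subst hβ hδ
  have hε : ε = -2 * α := by
    refine sub_eq_zero.1 (mul_left_cancel₀ hu2' ?_)
    linear_combination d0
  have hγ : ε = -2 * γ := by
    refine sub_eq_zero.1 (mul_left_cancel₀ hu2' ?_)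
    linear_combination d2
  obtain rfl : γ = α := by linarith
  subst hε
  -- By now `K = γ(a+b-c-d)²`, with value `γ(t-1)²` at `(t,1,1,1)`.
  have hα : γ = 0 := by
    refine mul_left_cancel₀ (pow_ne_zero 2 ht') ?_
    linear_combination ht0
  subst hα
  simp

/-- Write `G = (a-b)K`. Then `K` has double zeros at `(u,1,u,1)` and `(t,1,1,1)`, where `a ≠ b`, and
zeros at `(1,1,t,1)` and `(u,u,1,1)`, where `a-b` vanishes simply. -/
theorem eq_zero_of_antisymm_symm {t u : ℝ} (ht : t ≠ 1) (hu1 : u ≠ 1) (hu2 : u ≠ -1)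
    (htu : 2 * u ≠ t + 1) {G : MvPolynomial (Fin 4) ℝ} (hG : G ∈ doubleZeroForms t u)
    (h01 : rename (Equiv.swap (0 : Fin 4) 1) G = -G)
    (h23 : rename (Equiv.swap (2 : Fin 4) 3) G = G) : G = 0 := by
  obtain ⟨α, β, γ, δ, ε, ζ, η, θ, rfl⟩ := exists_eq_of_antisymm_symm hG.1 h01 h23
  have ht' : t - 1 ≠ 0 := sub_ne_zero.2 ht
  have hu' : u - 1 ≠ 0 := sub_ne_zero.2 hu1
  have hu2' : u + 1 ≠ 0 := fun h => hu2 (by linarith)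
  have htu' : 2 * u - (t + 1) ≠ 0 := sub_ne_zero.2 htu
  have hp := (doubleZeroForms.pair' hG).of_mul (by simp [hu'])
  have hq := (doubleZeroForms.triple hG).of_mul (by simp [ht'])
  have e1 := (doubleZeroForms.triple' hG).eval_eq_zero (v := ![1, 0, 0, 0]) (by simp)
    (by simp [dirDeriv_sub, dirDeriv_X])
  have e2 := (doubleZeroForms.pair hG).eval_eq_zero (v := ![1, 0, 0, 0]) (by simp)
    (by simp [dirDeriv_sub, dirDeriv_X])
  have d0 := hp.2 ![1, 0, 0, 0]
  have d1 := hp.2 ![0, 1, 0, 0]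
  have d2 := hp.2 ![0, 0, 1, 0]
  have d3 := hp.2 ![0, 0, 0, 1]
  have f0 := hq.2 ![1, 0, 0, 0]
  have f1 := hq.2 ![0, 1, 0, 0]
  have f := hq.1
  simp only [pow_succ, pow_zero, one_mul, dirDeriv_add, dirDeriv_mul, dirDeriv_C, dirDeriv_X,
    map_add, map_mul, eval_X, eval_C, Matrix.cons_val] at d0 d1 d2 d3 e1 e2 f0 f1 f
  -- The difference of the partial derivatives in `a` and `b` sees only the terms with `ab`;
  -- likewise for `c`, `d` and `cd`.
  have hδ : β + δ = 0 := by
    refine mul_left_cancel₀ (mul_ne_zero hu' hu2') ?_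
    linear_combination d1 - d0
  have hθ : ζ + θ = 0 := by
    refine mul_left_cancel₀ (mul_ne_zero hu' hu2') ?_
    linear_combination d3 - d2
  obtain rfl : δ = -β := by linarith
  obtain rfl : θ = -ζ := by linarith
  obtain rfl : β = 0 := by
    refine mul_left_cancel₀ (mul_ne_zero ht' ht') ?_
    linear_combination f1 - f0
  -- With `p = a+b` and `q = c+d`, this relation makes `p - q` divide `K`. The cofactor is `L = αp²
  -- + (α+γ)pq + (α+γ+ε)q² + ζcd`, and `g0` to `g3` below are conditions on `L`.
  have hη : α + γ + ε + η = 0 := by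
    refine mul_left_cancel₀ (mul_ne_zero (three_ne_zero (α := ℝ)) (pow_ne_zero 2 hu2')) ?_
    linear_combination d0 + d2
  obtain rfl : η = -α - γ - ε := by linarith
  have g0 : 2 * α * (t + 1) + 2 * (α + γ) = 0 := by
    refine mul_left_cancel₀ (pow_ne_zero 2 ht') ?_
    linear_combination (t - 1) * f0 - f
  have g1 : α * (t + 1) ^ 2 + 2 * (α + γ) * (t + 1) + 4 * (α + γ + ε) + ζ = 0 := by
    refine mul_left_cancel₀ ht' ?_
    linear_combination f
  have g2 : 4 * α + 2 * (α + γ) * (t + 1) + (α + γ + ε) * (t + 1) ^ 2 + ζ * t = 0 := by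
    refine mul_left_cancel₀ ht' ?_
    linear_combination -e1
  have g3 : 4 * α * u ^ 2 + 4 * (α + γ) * u + 4 * (α + γ + ε) + ζ = 0 := by
    refine mul_left_cancel₀ hu' ?_
    linear_combination e2 / 2
  -- For `q = 2`, `cd = 1`, `L` is a quadratic in `p` with leading coefficient `α`, a double root at
  -- `t+1` and a further root at `2u ≠ t+1`.
  obtain rfl : α = 0 := by
    refine mul_left_cancel₀ (pow_ne_zero 2 htu') ?_
    linear_combination g3 - g1 - 2 * u * g0 + (t + 1) * g0
  obtain rfl : γ = 0 := by linarith
  obtain rfl : ε = 0 := by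
    refine mul_left_cancel₀ (pow_ne_zero 2 ht') ?_
    linear_combination g2 - t * g1
  obtain rfl : ζ = 0 := by linarith
  simp

/-- The difference `H = G - τG` is antisymmetric under `τ`. Its parts symmetric and antisymmetric
under `ρ` both vanish by the two preceding lemmas. -/
theorem rename_swap01_eq {t u : ℝ} (ht : t ≠ 1) (hu1 : u ≠ 1) (hu2 : u ≠ -1)
    (htu : 2 * u ≠ t + 1) {G : MvPolynomial (Fin 4) ℝ} (hG : G ∈ doubleZeroForms t u) :
    rename (Equiv.swap (0 : Fin 4) 1) G = G := by
  set τ : Equiv.Perm (Fin 4) := Equiv.swap 0 1 with hτ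
  set ρ : Equiv.Perm (Fin 4) := Equiv.swap 2 3 with hρ
  have hττ : ∀ K : MvPolynomial (Fin 4) ℝ, rename τ (rename τ K) = K := fun K => by
    rw [rename_rename, show (τ : Fin 4 → Fin 4) ∘ τ = id by funext i; simp [hτ], rename_id]; rfl
  have hρρ : ∀ K : MvPolynomial (Fin 4) ℝ, rename ρ (rename ρ K) = K := fun K => by
    rw [rename_rename, show (ρ : Fin 4 → Fin 4) ∘ ρ = id by funext i; simp [hρ], rename_id]; rfl
  have hcomm : ∀ K : MvPolynomial (Fin 4) ℝ, rename τ (rename ρ K) = rename ρ (rename τ K) :=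
    fun K => by
      rw [rename_rename, rename_rename,
        show (τ : Fin 4 → Fin 4) ∘ ρ = ρ ∘ τ by funext i; fin_cases i <;> rfl]
  have hH := (doubleZeroForms t u).sub_mem hG (rename_mem_doubleZeroForms hG τ)
  have hρH := rename_mem_doubleZeroForms hH ρ
  have h1 := eq_zero_of_antisymm_symm ht hu1 hu2 htu ((doubleZeroForms t u).add_mem hH hρH)
    (by simp only [← hτ, map_add, map_sub, hcomm, hττ]; ring)
    (by simp only [← hρ, map_add, map_sub, hρρ]; ring)
  have h2 := eq_zero_of_antisymm_antisymm ht hu1 hu2 ((doubleZeroForms t u).sub_mem hH hρH)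
    (by simp only [← hτ, map_sub, hcomm, hττ]; ring)
    (by simp only [← hρ, map_sub, hρρ]; ring)
  have h3 : (2 : ℝ) • (G - rename τ G) = 0 := by
    rw [two_smul]
    linear_combination h1 + h2
  exact (sub_eq_zero.1 ((smul_eq_zero.1 h3).resolve_left two_ne_zero)).symm

theorem rename_swap_eq {t u : ℝ} (ht : t ≠ 1) (hu1 : u ≠ 1) (hu2 : u ≠ -1)
    (htu : 2 * u ≠ t + 1) {G : MvPolynomial (Fin 4) ℝ} (hG : G ∈ doubleZeroForms t u)
    (i j : Fin 4) (hij : i ≠ j) : rename (Equiv.swap i j) G = G := by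
  obtain ⟨π, rfl, rfl⟩ := exists_perm_of_ne hij
  have h := rename_swap01_eq ht hu1 hu2 htu (rename_mem_doubleZeroForms hG π⁻¹)
  have h' := congrArg (rename π) h
  rw [rename_rename, rename_rename, rename_rename] at h'
  have e1 : (π : Fin 4 → Fin 4) ∘ ⇑π⁻¹ = id := by funext i; simp
  have e2 : (π : Fin 4 → Fin 4) ∘ (⇑(Equiv.swap (0 : Fin 4) 1) ∘ ⇑π⁻¹)
      = Equiv.swap (π 0) (π 1) := by
    rw [Equiv.swap_apply_apply]
    rfl
  rw [e1, rename_id] at h'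
  rw [Function.comp_assoc, e2] at h'
  exact h'

/-- `G` is symmetric, hence a combination of `s0`, …, `s4`. Vanishing at `(1,1,1,1)` removes `s4`,
and the double zeros at `(u,u,1,1)` and `(t,1,1,1)` give two equations each for the other four
coefficients. -/
theorem eq_zero_of_eval_one_eq_zero {t u : ℝ} (ht : t ≠ 1) (hu0 : u ≠ 0) (hu1 : u ≠ 1)
    (hu2 : u ≠ -1) (htu : 2 * u ≠ t + 1) {G : MvPolynomial (Fin 4) ℝ}
    (hG : G ∈ doubleZeroForms t u) (h1 : eval ![1, 1, 1, 1] G = 0) : G = 0 := by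
  obtain ⟨x₀, x₁, x₂, x₃, x₄, rfl⟩ :=
    exists_eq_of_symm hG.1 (rename_swap_eq ht hu1 hu2 htu hG)
  have ht' : t - 1 ≠ 0 := sub_ne_zero.2 ht
  have hu' : u - 1 ≠ 0 := sub_ne_zero.2 hu1
  have hu2' : u + 1 ≠ 0 := fun h => hu2 (by linarith)
  have a0 := (doubleZeroForms.pair hG).1
  have a1 := (doubleZeroForms.pair hG).2 ![1, 1, 0, 0]
  have b0 := (doubleZeroForms.triple hG).1
  have b1 := (doubleZeroForms.triple hG).2 ![1, 0, 0, 0]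
  have i1 : (1 : Fin 4) + 1 = 2 := rfl
  have i2 : (1 : Fin 4) + 2 = 3 := rfl
  have i3 : (1 : Fin 4) + 3 = 0 := rfl
  have i4 : (2 : Fin 4) + 1 = 3 := rfl
  have i5 : (2 : Fin 4) + 2 = 0 := rfl
  have i6 : (2 : Fin 4) + 3 = 1 := rfl
  have i7 : (3 : Fin 4) + 1 = 0 := rfl
  have i8 : (3 : Fin 4) + 2 = 1 := rfl
  have i9 : (3 : Fin 4) + 3 = 2 := rfl
  simp only [s0, s1, s2, s3, s4, U4, S22_eq, S4, T31, T211, Fin.sum_univ_four, zero_add, i1, i2, i3,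
    i4, i5, i6, i7, i8, i9, map_add, map_sub, map_mul,
    map_pow, eval_X, eval_C, map_ofNat, dirDeriv_add, dirDeriv_sub, dirDeriv_mul, dirDeriv_C,
    dirDeriv_ofNat, dirDeriv_X, dirDeriv_X_pow, Matrix.cons_val] at h1 a0 a1 b0 b1
  norm_num at h1 a1 b1
  subst h1
  -- `G(u,u,1,1)` is `(u-1)²` times this expression; `c1` comes from its derivative in `u`.
  have c0 : (2 * x₀ + 2 * x₁ + x₂) * (u + 1) ^ 2 + 4 * (x₁ + x₃) * u = 0 := by
    refine mul_left_cancel₀ (pow_ne_zero 2 hu') ?_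
    linear_combination a0
  have c1 : 4 * (2 * x₀ + 2 * x₁ + x₂) * u * (u + 1) + 4 * (x₁ + x₃) * (3 * u - 1) = 0 := by
    refine mul_left_cancel₀ hu' ?_
    linear_combination a1
  have c2 : 2 * x₀ + 2 * x₁ + x₂ = 0 := by
    refine mul_left_cancel₀ (mul_ne_zero hu2' (pow_ne_zero 2 hu')) ?_
    linear_combination u * c1 - (3 * u - 1) * c0
  have c3 : x₁ + x₃ = 0 := by
    refine mul_left_cancel₀ (mul_ne_zero four_ne_zero hu0) ?_
    linear_combination c0 - (u + 1) ^ 2 * c2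
  obtain rfl : x₃ = -x₁ := by linarith
  obtain rfl : x₂ = -2 * x₀ - 2 * x₁ := by linarith
  -- Now `G(t,1,1,1) = (t-1)³(x₀(t+3) + 3x₁)`. A double zero at `t ≠ 1` kills the linear factor.
  have g0 : x₀ * (t + 3) + 3 * x₁ = 0 := by
    refine mul_left_cancel₀ (pow_ne_zero 3 ht') ?_
    linear_combination b0
  obtain rfl : x₀ = 0 := by
    refine mul_left_cancel₀ (pow_ne_zero 3 ht') ?_
    linear_combination b1 - 3 * (t - 1) ^ 2 * g0
  obtain rfl : x₁ = 0 := by linarith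
  simp

/-! ### Extremality -/

theorem mem_doubleZeroForms_of_nonneg {t u : ℝ} (hu : u ≠ 0) {G : MvPolynomial (Fin 4) ℝ}
    (hG : G.IsHomogeneous 4) (h : ∀ x, 0 ≤ eval x G)
    (hle : ∀ x, eval x G ≤ eval x (quartic t u)) : G ∈ doubleZeroForms t u := by
  refine ⟨hG, fun σ => ⟨isDoubleZero_of_nonneg h (le_antisymm ?_ (h _)),
    isDoubleZero_of_nonneg h (le_antisymm ?_ (h _))⟩⟩
  · refine (hle _).trans_eq ?_
    rw [eval_quartic_comp_perm, eval_quartic_triple]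
  · refine (hle _).trans_eq ?_
    rw [eval_quartic_comp_perm, eval_quartic_pair t hu]

theorem eval_one_quartic_pos {t u : ℝ} (ht : t ≠ 1) (hu : u ≠ 0) (hu1 : u ≠ 1) :
    0 < eval ![1, 1, 1, 1] (quartic t u) := by
  have : eval ![1, 1, 1, 1] (quartic t u) = u ^ 2 * (2 * (t - 1) ^ 4 * omega u ^ 2) := by
    rw [eval_quartic]
    simp only [quarticFun, p0, p1, p2, p3, p4, Matrix.cons_val]
    ring
  have ht' : t - 1 ≠ 0 := sub_ne_zero.2 ht
  have hw := omega_ne_zero hu hu1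
  rw [this]
  positivity

/-- A PSD summand `g` lies between 0 and the quartic, so it inherits the double zeros. Subtracting
the multiple of the quartic with the same value at `(1,1,1,1)` leaves zero. -/
theorem quartic_mem_extremals {t u : ℝ} (ht : t ≠ 1) (hu : u ≠ 0) (hu1 : u ≠ 1)
    (hu2 : u ≠ -1) (htu : 2 * u ≠ t + 1) (hV : 0 ≤ VF t (omega u)) :
    quartic t u ∈ extremals (PSD 4 4) := by
  have hpos := eval_one_quartic_pos ht hu hu1
  have hf : quartic t u ∈ PSD 4 4 :=
    ⟨isHomogeneous_quartic t u, fun v _ => eval_quartic_nonneg hV v⟩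
  have hfW := mem_doubleZeroForms_of_nonneg hu (isHomogeneous_quartic t u)
    (eval_quartic_nonneg hV) (fun _ => le_rfl)
  have key : ∀ g ∈ PSD 4 4, ∀ h ∈ PSD 4 4, g + h = quartic t u →
      ∃ α : ℝ, 0 ≤ α ∧ g = α • quartic t u := by
    intro g hg h hh hgh
    have hgW : g ∈ doubleZeroForms t u := mem_doubleZeroForms_of_nonneg hu hg.1
      (fun x => hg.2 x trivial) (fun x => by
        rw [← hgh, map_add]
        linarith [hh.2 x trivial])
    refine ⟨eval ![1, 1, 1, 1] g / eval ![1, 1, 1, 1] (quartic t u),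
      div_nonneg (hg.2 _ trivial) hpos.le, sub_eq_zero.1 ?_⟩
    refine eq_zero_of_eval_one_eq_zero ht hu hu1 hu2 htu
      ((doubleZeroForms t u).sub_mem hgW ((doubleZeroForms t u).smul_mem _ hfW)) ?_
    rw [map_sub, smul_eval, div_mul_cancel₀ _ hpos.ne', sub_self]
  refine ⟨hf, fun h0 => ?_, fun g hg h hh hgh =>
    ⟨key g hg h hh hgh, key h hh g hg ((add_comm _ _).trans hgh)⟩⟩
  rw [h0, map_zero] at hpos
  exact lt_irrefl _ hpos

/-! ### Factors of homogeneous polynomials -/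

/-- The substitution `Xᵢ ↦ Xᵢ T`. -/
def homogenizeHom (n : ℕ) (R : Type*) [CommRing R] :
    MvPolynomial (Fin n) R →ₐ[R] Polynomial (MvPolynomial (Fin n) R) :=
  aeval fun i => Polynomial.C (X i) * Polynomial.X

theorem homogenizeHom_of_isHomogeneous {n k : ℕ} {R : Type*} [CommRing R]
    {G : MvPolynomial (Fin n) R} (hG : G.IsHomogeneous k) :
    homogenizeHom n R G = Polynomial.C G * Polynomial.X ^ k := by
  have h1 : homogenizeHom n R G = eval
      ((Polynomial.X : Polynomial (MvPolynomial (Fin n) R)) •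
        fun i => Polynomial.C (X i : MvPolynomial (Fin n) R))
      (map (algebraMap R (Polynomial (MvPolynomial (Fin n) R))) G) := by
    rw [eval_map, homogenizeHom, aeval_def]
    congr 1
    funext i
    rw [Pi.smul_apply, smul_eq_mul, mul_comm]
  have h2 : eval (fun i => Polynomial.C (X i : MvPolynomial (Fin n) R))
      (map (algebraMap R (Polynomial (MvPolynomial (Fin n) R))) G) = Polynomial.C G := by
    rw [eval_map]
    have := (MvPolynomial.eval₂_comp_left Polynomial.C C (X : Fin n → MvPolynomial (Fin n) R) G)
    rw [eval₂_eta] at this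
    rw [this]
    rfl
  rw [h1, eval_smul_of_isHomogeneous (hG.map _), h2, mul_comm]

theorem homogenizeHom_eq_sum {n : ℕ} {R : Type*} [CommRing R] (G : MvPolynomial (Fin n) R) :
    homogenizeHom n R G = ∑ i ∈ Finset.range (G.totalDegree + 1),
      Polynomial.C (homogeneousComponent i G) * Polynomial.X ^ i := by
  conv_lhs => rw [← sum_homogeneousComponent G, map_sum]
  exact Finset.sum_congr rfl fun i _ =>
    homogenizeHom_of_isHomogeneous (homogeneousComponent_isHomogeneous i G)

theorem coeff_homogenizeHom {n : ℕ} {R : Type*} [CommRing R] (G : MvPolynomial (Fin n) R)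
    (k : ℕ) : (homogenizeHom n R G).coeff k = homogeneousComponent k G := by
  rw [homogenizeHom_eq_sum, Polynomial.finsetSum_coeff]
  simp only [Polynomial.coeff_C_mul_X_pow]
  rw [Finset.sum_ite_eq]
  split_ifs with h
  · rfl
  · exact (homogeneousComponent_eq_zero _ _ (by simpa using h)).symm

theorem homogenizeHom_ne_zero {n : ℕ} {R : Type*} [CommRing R] {G : MvPolynomial (Fin n) R}
    (hG : G ≠ 0) : homogenizeHom n R G ≠ 0 := by
  intro h
  refine hG ?_
  rw [← sum_homogeneousComponent G]
  refine Finset.sum_eq_zero fun i _ => ?_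
  rw [← coeff_homogenizeHom, h, Polynomial.coeff_zero]

theorem isHomogeneous_of_natDegree_le {n : ℕ} {R : Type*} [CommRing R]
    {G : MvPolynomial (Fin n) R}
    (h : (homogenizeHom n R G).natDegree ≤ (homogenizeHom n R G).natTrailingDegree) :
    G.IsHomogeneous (homogenizeHom n R G).natDegree := by
  have : G = homogeneousComponent (homogenizeHom n R G).natDegree G := by
    conv_lhs => rw [← sum_homogeneousComponent G]
    refine Finset.sum_eq_single _ (fun i _ hi => ?_) (fun hi => ?_)
    · rw [← coeff_homogenizeHom]
      rcases hi.lt_or_gt with hi | hi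
      · exact Polynomial.coeff_eq_zero_of_lt_natTrailingDegree (hi.trans_le h)
      · exact Polynomial.coeff_eq_zero_of_natDegree_lt hi
    · exact homogeneousComponent_eq_zero _ _ (by simpa using hi)
  have h' := homogeneousComponent_isHomogeneous (homogenizeHom n R G).natDegree G
  rwa [← this] at h'

/-- Under `Xᵢ ↦ XᵢT` a form becomes a monomial in `T`. Degree and trailing degree in `T` are both
additive over a domain, so they agree for each factor if they agree for the product. -/
theorem isHomogeneous_factors {n k : ℕ} {R : Type*} [CommRing R] [IsDomain R]
    {G H : MvPolynomial (Fin n) R} (hGH : (G * H).IsHomogeneous k) (h0 : G * H ≠ 0) :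
    ∃ i j, i + j = k ∧ G.IsHomogeneous i ∧ H.IsHomogeneous j := by
  have hG := homogenizeHom_ne_zero (left_ne_zero_of_mul h0)
  have hH := homogenizeHom_ne_zero (right_ne_zero_of_mul h0)
  have h := homogenizeHom_of_isHomogeneous hGH
  rw [map_mul] at h
  have h1 := Polynomial.natDegree_mul hG hH
  have h2 := Polynomial.natTrailingDegree_mul hG hH
  rw [h, Polynomial.natDegree_C_mul_X_pow _ _ h0] at h1
  rw [h, Polynomial.C_mul_X_pow_eq_monomial, Polynomial.natTrailingDegree_monomial h0] at h2
  have h3 := Polynomial.natTrailingDegree_le_natDegree (homogenizeHom n R G)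
  have h4 := Polynomial.natTrailingDegree_le_natDegree (homogenizeHom n R H)
  exact ⟨_, _, h1.symm, isHomogeneous_of_natDegree_le (by omega),
    isHomogeneous_of_natDegree_le (by omega)⟩

theorem eq_C_of_isHomogeneous_zero {n : ℕ} {R : Type*} [CommRing R] {G : MvPolynomial (Fin n) R}
    (hG : G.IsHomogeneous 0) : ∃ r, G = C r :=
  ⟨_, totalDegree_eq_zero_iff_eq_C.1 ((totalDegree_zero_iff_isHomogeneous _).2 hG)⟩

/-! ### Real and imaginary parts of complex polynomials -/

/-- The polynomial with the real parts of the coefficients. -/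
def rePart {n : ℕ} (p : MvPolynomial (Fin n) ℂ) : MvPolynomial (Fin n) ℝ :=
  ∑ d ∈ p.support, monomial d (coeff d p).re

/-- The polynomial with the imaginary parts of the coefficients. -/
def imPart {n : ℕ} (p : MvPolynomial (Fin n) ℂ) : MvPolynomial (Fin n) ℝ :=
  ∑ d ∈ p.support, monomial d (coeff d p).im

theorem coeff_rePart {n : ℕ} (p : MvPolynomial (Fin n) ℂ) (d : Fin n →₀ ℕ) :
    coeff d (rePart p) = (coeff d p).re := by
  classical
  simp only [rePart, coeff_sum, coeff_monomial, Finset.sum_ite_eq']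
  split_ifs with h
  · rfl
  · rw [notMem_support_iff.1 h, Complex.zero_re]

theorem coeff_imPart {n : ℕ} (p : MvPolynomial (Fin n) ℂ) (d : Fin n →₀ ℕ) :
    coeff d (imPart p) = (coeff d p).im := by
  classical
  simp only [imPart, coeff_sum, coeff_monomial, Finset.sum_ite_eq']
  split_ifs with h
  · rfl
  · rw [notMem_support_iff.1 h, Complex.zero_im]

theorem isHomogeneous_rePart {n k : ℕ} {p : MvPolynomial (Fin n) ℂ} (hp : p.IsHomogeneous k) :
    (rePart p).IsHomogeneous k := fun {d} hd => hp (d := d) fun h => hd (by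
      rw [coeff_rePart, h, Complex.zero_re])

theorem isHomogeneous_imPart {n k : ℕ} {p : MvPolynomial (Fin n) ℂ} (hp : p.IsHomogeneous k) :
    (imPart p).IsHomogeneous k := fun {d} hd => hp (d := d) fun h => hd (by
      rw [coeff_imPart, h, Complex.zero_im])

theorem map_rePart_add_imPart {n : ℕ} (p : MvPolynomial (Fin n) ℂ) :
    map (algebraMap ℝ ℂ) (rePart p) + C Complex.I * map (algebraMap ℝ ℂ) (imPart p) = p := by
  ext d
  rw [coeff_add, coeff_C_mul, coeff_map, coeff_map, coeff_rePart, coeff_imPart, mul_comm]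
  exact Complex.re_add_im _

theorem eval_map_ofReal {n : ℕ} (f : MvPolynomial (Fin n) ℝ) (x : Fin n → ℝ) :
    eval (fun i => (x i : ℂ)) (map (algebraMap ℝ ℂ) f) = (eval x f : ℂ) := by
  rw [eval_map]
  exact (eval₂_comp_left (algebraMap ℝ ℂ) (RingHom.id ℝ) x f).symm

theorem eval_ofReal_eq {n : ℕ} (p : MvPolynomial (Fin n) ℂ) (x : Fin n → ℝ) :
    eval (fun i => (x i : ℂ)) p = eval x (rePart p) + eval x (imPart p) * Complex.I := by
  conv_lhs => rw [← map_rePart_add_imPart p]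
  rw [map_add, map_mul, eval_C, eval_map_ofReal, eval_map_ofReal, mul_comm]

theorem eval_ofReal_re {n : ℕ} (p : MvPolynomial (Fin n) ℂ) (x : Fin n → ℝ) :
    (eval (fun i => (x i : ℂ)) p).re = eval x (rePart p) := by
  simp [eval_ofReal_eq]

theorem eval_ofReal_im {n : ℕ} (p : MvPolynomial (Fin n) ℂ) (x : Fin n → ℝ) :
    (eval (fun i => (x i : ℂ)) p).im = eval x (imPart p) := by
  simp [eval_ofReal_eq]

theorem eval_map_conj {n : ℕ} (p : MvPolynomial (Fin n) ℂ) (x : Fin n → ℝ) :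
    eval (fun i => (x i : ℂ)) (map (starRingEnd ℂ) p)
      = starRingEnd ℂ (eval (fun i => (x i : ℂ)) p) := by
  rw [eval_map]
  refine Eq.trans ?_ (eval₂_comp_left (starRingEnd ℂ) (RingHom.id ℂ) _ p).symm
  congr 1
  funext i
  simp

theorem map_conj_map_ofReal {n : ℕ} (f : MvPolynomial (Fin n) ℝ) :
    map (starRingEnd ℂ) (map (algebraMap ℝ ℂ) f) = map (algebraMap ℝ ℂ) f := by
  have h : (starRingEnd ℂ).comp (algebraMap ℝ ℂ) = algebraMap ℝ ℂ := by
    ext x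
    simp
  rw [map_map, h]

/-- The real zeros of a complex form proportional to its conjugate are those of a real form. -/
theorem exists_real_form_of_conj {n k : ℕ} {p : MvPolynomial (Fin n) ℂ} (hp : p.IsHomogeneous k)
    {c : ℂ} (hc : map (starRingEnd ℂ) p = C c * p) :
    ∃ D : MvPolynomial (Fin n) ℝ, D.IsHomogeneous k ∧
      ∀ x : Fin n → ℝ, eval (fun i => (x i : ℂ)) p = 0 ↔ eval x D = 0 := by
  have key : ∀ x : Fin n → ℝ, (eval x (rePart p) : ℂ) - eval x (imPart p) * Complex.I
      = c * (eval x (rePart p) + eval x (imPart p) * Complex.I) := by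
    intro x
    have := congrArg (eval fun i => (x i : ℂ)) hc
    rw [eval_map_conj, map_mul, eval_C, eval_ofReal_eq] at this
    simpa [sub_eq_add_neg] using this
  -- At real points `A - iB = c(A + iB)` for the real and imaginary parts. If `c = -1` then `A = 0`
  -- there and `B` has the same zeros; otherwise `A = 0` forces `B = 0`.
  by_cases h : c = -1
  · refine ⟨imPart p, isHomogeneous_imPart hp, fun x => ?_⟩
    have hx := key x
    rw [h] at hx
    have h0 : (eval x (rePart p) : ℂ) = 0 := by linear_combination hx / 2
    rw [eval_ofReal_eq, h0, zero_add, mul_eq_zero, Complex.ofReal_eq_zero]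
    simp
  · refine ⟨rePart p, isHomogeneous_rePart hp, fun x => ⟨fun hx => ?_, fun hx => ?_⟩⟩
    · rw [← eval_ofReal_re, hx, Complex.zero_re]
    · have hx' := key x
      have h1 : (1 + c) * (eval x (imPart p) * Complex.I) = 0 := by
        rw [hx, Complex.ofReal_zero] at hx'
        linear_combination -hx'
      have h2 : 1 + c ≠ 0 := fun h' => h (by linear_combination h')
      rw [eval_ofReal_eq, hx, (mul_eq_zero.1 h1).resolve_left h2, Complex.ofReal_zero, zero_add]

/-! ### Zeros of linear and quadratic forms -/

theorem exists_eval_linear_form {G : MvPolynomial (Fin 4) ℝ} (hG : G.IsHomogeneous 1) :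
    ∃ L : (Fin 4 → ℝ) →ₗ[ℝ] ℝ, ∀ x, eval x G = L x := by
  have hl : List.Nat.antidiagonalTuple 4 1 = [![0, 0, 0, 1], ![0, 0, 1, 0], ![0, 1, 0, 0],
      ![1, 0, 0, 0]] := by decide
  have hv : (Finset.Nat.antidiagonalTuple 4 1).val = List.Nat.antidiagonalTuple 4 1 := rfl
  refine ⟨coeff4 G 0 0 0 1 • LinearMap.proj 3 + coeff4 G 0 0 1 0 • LinearMap.proj 2
    + coeff4 G 0 1 0 0 • LinearMap.proj 1 + coeff4 G 1 0 0 0 • LinearMap.proj 0, fun x => ?_⟩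
  rw [eval_eq_sum_antidiagonalTuple hG, Finset.sum_eq_multiset_sum, hv, hl, Multiset.map_coe,
    Multiset.sum_coe]
  simp only [List.map_cons, List.map_nil, List.sum_cons, List.sum_nil, Fin.prod_univ_four, coeff4,
    Matrix.cons_val, LinearMap.add_apply, LinearMap.smul_apply, LinearMap.proj_apply, smul_eq_mul]
  ring

theorem exists_eval_quadratic_form {G : MvPolynomial (Fin 4) ℝ} (hG : G.IsHomogeneous 2) :
    ∃ B : (Fin 4 → ℝ) → (Fin 4 → ℝ) → ℝ,
      (∀ (r s : ℝ) x y, eval (r • x + s • y) G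
        = r ^ 2 * eval x G + r * s * B x y + s ^ 2 * eval y G) ∧
      ∀ (r : ℝ) x y z, B x (y + r • z) = B x y + r * B x z := by
  have hl : List.Nat.antidiagonalTuple 4 2 = [![0, 0, 0, 2], ![0, 0, 1, 1], ![0, 0, 2, 0],
      ![0, 1, 0, 1], ![0, 1, 1, 0], ![0, 2, 0, 0], ![1, 0, 0, 1], ![1, 0, 1, 0], ![1, 1, 0, 0],
      ![2, 0, 0, 0]] := by decide
  have hv : (Finset.Nat.antidiagonalTuple 4 2).val = List.Nat.antidiagonalTuple 4 2 := rfl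
  have key : ∀ x : Fin 4 → ℝ, eval x G = coeff4 G 0 0 0 2 * x 3 ^ 2 + coeff4 G 0 0 1 1 * (x 2 * x 3)
      + coeff4 G 0 0 2 0 * x 2 ^ 2 + coeff4 G 0 1 0 1 * (x 1 * x 3) + coeff4 G 0 1 1 0 * (x 1 * x 2)
      + coeff4 G 0 2 0 0 * x 1 ^ 2 + coeff4 G 1 0 0 1 * (x 0 * x 3) + coeff4 G 1 0 1 0 * (x 0 * x 2)
      + coeff4 G 1 1 0 0 * (x 0 * x 1) + coeff4 G 2 0 0 0 * x 0 ^ 2 := by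
    intro x
    rw [eval_eq_sum_antidiagonalTuple hG, Finset.sum_eq_multiset_sum, hv, hl, Multiset.map_coe,
      Multiset.sum_coe]
    simp only [List.map_cons, List.map_nil, List.sum_cons, List.sum_nil, Fin.prod_univ_four,
      coeff4, Matrix.cons_val]
    ring
  refine ⟨fun x y => eval (x + y) G - eval x G - eval y G, fun r s x y => ?_, fun r x y z => ?_⟩
  · simp only [key, Pi.add_apply, Pi.smul_apply, smul_eq_mul]
    ring
  · simp only [key, Pi.add_apply, Pi.smul_apply, smul_eq_mul]
    ring

/-- If a form vanishes on a line of `ℙ³`, then it has infinitely many real zeros. -/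
theorem infinite_realZeros_of_line {k : ℕ} {f : MvPolynomial (Fin 4) ℝ} (hf : f.IsHomogeneous k)
    {x y : Fin 4 → ℝ} (hxy : LinearIndependent ℝ ![x, y])
    (h : ∀ s : ℝ, eval (x + s • y) f = 0) : (realZeros f).Infinite := by
  rw [LinearIndependent.pair_iff] at hxy
  have hne : ∀ s : ℝ, x + s • y ≠ 0 := fun s hs =>
    one_ne_zero (hxy 1 s (by rwa [one_smul])).1
  refine Set.infinite_of_injective_forall_mem
    (f := fun s : ℝ => Projectivization.mk ℝ (x + s • y) (hne s)) (fun s s' hs => ?_)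
    (fun s => (mk_mem_realZeros_iff hf (hne s)).2 (h s))
  obtain ⟨r, hr⟩ := (Projectivization.mk_eq_mk_iff' ℝ _ _ _ _).1 hs
  have := hxy (r - 1) (r * s' - s) (by
    rw [sub_smul, sub_smul, one_smul, mul_smul, ← sub_eq_zero.2 hr, smul_add]
    abel)
  have h1 : r = 1 := by linarith [this.1]
  have h2 := this.2
  rw [h1] at h2
  linarith

/-- The real and imaginary parts of `p` are two real linear forms in four variables, so their common
kernel contains a projective line, on which `f` vanishes. -/
theorem infinite_realZeros_of_linear_factor {k : ℕ} {f : MvPolynomial (Fin 4) ℝ}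
    (hf : f.IsHomogeneous k) {p : MvPolynomial (Fin 4) ℂ} (hp : p.IsHomogeneous 1)
    (hdvd : p ∣ map (algebraMap ℝ ℂ) f) : (realZeros f).Infinite := by
  obtain ⟨L₁, h₁⟩ := exists_eval_linear_form (isHomogeneous_rePart hp)
  obtain ⟨L₂, h₂⟩ := exists_eval_linear_form (isHomogeneous_imPart hp)
  have hrank := (L₁.prod L₂).finrank_range_add_finrank_ker
  have hle := (LinearMap.range (L₁.prod L₂)).finrank_le
  rw [Module.finrank_prod, Module.finrank_self] at hle
  rw [Module.finrank_fin_fun] at hrank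
  have hpos : 0 < Module.finrank ℝ (LinearMap.ker (L₁.prod L₂)) := by omega
  obtain ⟨x, hx⟩ : ∃ x : LinearMap.ker (L₁.prod L₂), x ≠ 0 :=
    Module.finrank_pos_iff_exists_ne_zero.1 hpos
  obtain ⟨y, hy⟩ := exists_linearIndependent_pair_of_one_lt_finrank (R := ℝ) (by omega) hx
  have hli : LinearIndependent ℝ ![(x : Fin 4 → ℝ), y] := by
    rw [LinearIndependent.pair_iff] at hy ⊢
    exact fun a b h => hy a b (Subtype.ext h)
  refine infinite_realZeros_of_line hf hli fun s => ?_
  have hmem := (x + s • y).2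
  simp only [Submodule.coe_add, Submodule.coe_smul, LinearMap.mem_ker, LinearMap.prod_apply,
    Function.prod_apply, Prod.mk_eq_zero] at hmem
  obtain ⟨q, hq⟩ := hdvd
  have := congrArg (eval fun i => (((x : Fin 4 → ℝ) + s • (y : Fin 4 → ℝ)) i : ℂ)) hq
  rw [eval_map_ofReal, map_mul, eval_ofReal_eq p, h₁, h₂, hmem.1, hmem.2] at this
  simpa using this

/-- A real quadratic form in four variables with finitely many real zeros has at most one. -/
theorem realZeros_quadratic_subsingleton {D : MvPolynomial (Fin 4) ℝ} (hD : D.IsHomogeneous 2)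
    (hfin : (realZeros D).Finite) : (realZeros D).Subsingleton := by
  intro p hp q hq
  by_contra hne
  refine Set.not_infinite.2 hfin ?_
  induction p using Projectivization.ind with | h x hx =>
  induction q using Projectivization.ind with | h y hy =>
  rw [mk_mem_realZeros_iff hD] at hp hq
  have hxy : LinearIndependent ℝ ![x, y] := by
    rw [LinearIndependent.pair_iff' hx]
    rintro a rfl
    refine hne ((Projectivization.mk_eq_mk_iff' ℝ _ _ _ _).2 ⟨a⁻¹, ?_⟩)
    have ha : a ≠ 0 := by rintro rfl; simp at hy
    rw [smul_smul, inv_mul_cancel₀ ha, one_smul]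
  obtain ⟨B, hB, hB'⟩ := exists_eval_quadratic_form hD
  by_cases hBxy : B x y = 0
  · refine infinite_realZeros_of_line hD hxy fun s => ?_
    have := hB 1 s x y
    rw [one_smul] at this
    rw [this, hp, hq, hBxy]
    ring
  obtain ⟨z, hz⟩ := exists_linearIndependent_snoc_of_lt_finrank hxy
    (by rw [Module.finrank_fin_fun]; norm_num)
  rw [Fintype.linearIndependent_iff] at hz
  have hli : ∀ a b c : ℝ, a • x + b • y + c • z = 0 → a = 0 ∧ b = 0 ∧ c = 0 := by
    intro a b c h
    have := hz ![a, b, c] (by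
      rw [Fin.sum_univ_three]
      exact h)
    exact ⟨this 0, this 1, this 2⟩
  -- Projection from `x`: the line joining `x` to `y + rz` meets the quadric again in `w r`. These
  -- points are distinct for distinct `r` in `S`, where `B(x, y + rz) ≠ 0`.
  set w : ℝ → Fin 4 → ℝ := fun r =>
    eval (y + r • z) D • x + (-(B x y + r * B x z)) • (y + r • z) with hw
  have hw' : ∀ r, w r = eval (y + r • z) D • x + (-(B x y + r * B x z)) • y
      + (-(B x y + r * B x z) * r) • z := fun r => by
    rw [hw, mul_smul]
    simp only [smul_add]
    abel
  have hw0 : ∀ r, eval (w r) D = 0 := fun r => by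
    rw [hw]
    simp only []
    rw [hB, hB', hp]
    ring
  set S : Set ℝ := {r | B x y + r * B x z ≠ 0} with hS
  have hSinf : S.Infinite := by
    refine (Set.finite_singleton (-(B x y) / B x z)).infinite_compl.mono ?_
    intro r hr h0
    refine hr ?_
    have hz0 : B x z ≠ 0 := by
      intro h
      rw [h, mul_zero, add_zero] at h0
      exact hBxy h0
    rw [Set.mem_singleton_iff, eq_div_iff hz0]
    linarith
  have hwne : ∀ r : S, w r ≠ 0 := fun r h => by
    rw [hw'] at h
    exact r.2 (neg_eq_zero.1 (hli _ _ _ h).2.1)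
  have : Infinite S := hSinf.to_subtype
  refine Set.infinite_of_injective_forall_mem
    (f := fun r : S => Projectivization.mk ℝ (w r) (hwne r)) (fun r r' h => ?_)
    (fun r => (mk_mem_realZeros_iff hD (hwne r)).2 (hw0 r))
  obtain ⟨a, ha⟩ := (Projectivization.mk_eq_mk_iff' ℝ _ _ _ _).1 h
  have h3 := hli (a * eval (y + (r' : ℝ) • z) D - eval (y + (r : ℝ) • z) D)
    (a * (-(B x y + r' * B x z)) - (-(B x y + r * B x z)))
    (a * (-(B x y + r' * B x z) * r') - (-(B x y + r * B x z) * r)) (by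
      rw [← sub_eq_zero.2 ha, hw', hw']
      module)
  refine Subtype.ext ?_
  have h4 : (B x y + r * B x z) * ((r : ℝ) - r') = 0 := by
    linear_combination h3.2.2 - r' * h3.2.1
  linarith [(mul_eq_zero.1 h4).resolve_left r.2]

/-! ### Irreducibility -/

theorem ncard_realZeros_quadratic_le_one {D : MvPolynomial (Fin 4) ℝ} (hD : D.IsHomogeneous 2)
    (hfin : (realZeros D).Finite) : (realZeros D).ncard ≤ 1 :=
  (Set.ncard_le_one hfin).2 fun _ ha _ hb => realZeros_quadratic_subsingleton hD hfin ha hb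

/-- An extremal form with finitely many, but at least two, real zeros does not dominate the square
of a nonzero quadratic form. -/
theorem eq_zero_of_sq_add_eq_extremal {f q h : MvPolynomial (Fin 4) ℝ} (hf : f ∈ extremals (PSD 4 4))
    (hcard : 2 ≤ (realZeros f).ncard) {r : ℝ} (hr : 0 < r) (hq : q.IsHomogeneous 2)
    (hh : h ∈ PSD 4 4) (hqh : C r * q ^ 2 + h = f) : q = 0 := by
  have hq2 : (C r * q ^ 2).IsHomogeneous 4 := (hq.pow 2).C_mul r
  have hfin : (realZeros f).Finite := Set.finite_of_ncard_pos (by omega)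
  obtain ⟨⟨α, -, hα⟩, -⟩ := hf.2.2 (C r * q ^ 2)
    ⟨hq2, fun x _ => by rw [map_mul, map_pow, eval_C]; positivity⟩ h hh hqh
  by_contra hq0
  have hα0 : α ≠ 0 := by
    rintro rfl
    rw [zero_smul] at hα
    rcases mul_eq_zero.1 hα with h' | h'
    · exact hr.ne' (C_eq_zero.1 h')
    · exact hq0 (pow_eq_zero_iff two_ne_zero |>.1 h')
  have hzero : realZeros f = realZeros q := by
    ext p
    induction p using Projectivization.ind with | h x hx =>
    rw [mk_mem_realZeros_iff hf.1.1, mk_mem_realZeros_iff hq]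
    have := congrArg (eval x) hα
    rw [map_mul, map_pow, eval_C, smul_eval] at this
    constructor
    · intro h0
      rw [h0, mul_zero] at this
      exact pow_eq_zero_iff two_ne_zero |>.1 ((mul_eq_zero.1 this).resolve_left hr.ne')
    · intro h0
      rw [h0, zero_pow two_ne_zero, mul_zero] at this
      exact (mul_eq_zero.1 this.symm).resolve_left hα0
  rw [hzero] at hfin hcard
  have := ncard_realZeros_quadratic_le_one hq hfin
  omega

/-- Each square in a representation is dominated by `f`, hence zero, contradicting `f ≠ 0`. -/
theorem notMem_SOS_of_extremal {f : MvPolynomial (Fin 4) ℝ} (hf : f ∈ extremals (PSD 4 4))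
    (hcard : 2 ≤ (realZeros f).ncard) : f ∉ SOS 4 2 := by
  rintro ⟨r, g, hg, rfl⟩
  refine hf.2.1 (Finset.sum_eq_zero fun i _ => ?_)
  have hi : g i = 0 := by
    refine eq_zero_of_sq_add_eq_extremal (h := ∑ j ∈ Finset.univ.erase i, g j ^ 2) hf hcard
      one_pos (hg i) ⟨?_, fun x _ => ?_⟩ ?_
    · exact IsHomogeneous.sum _ _ _ fun j _ => (show (g j).IsHomogeneous 2 from hg j).pow 2
    · rw [map_sum]
      exact Finset.sum_nonneg fun j _ => by rw [map_pow]; positivity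
    · rw [C_1, one_mul, Finset.add_sum_erase _ (fun j => g j ^ 2) (Finset.mem_univ i)]
  rw [hi, zero_pow two_ne_zero]

/-- If a form `q` divides a nonzero form `p` of the same degree, they are proportional. -/
theorem eq_C_mul_of_dvd {n k : ℕ} {p q : MvPolynomial (Fin n) ℂ} (hp : p.IsHomogeneous k)
    (hq : q.IsHomogeneous k) (hp0 : p ≠ 0) (h : q ∣ p) : ∃ c : ℂ, c ≠ 0 ∧ p = C c * q := by
  obtain ⟨s, rfl⟩ := h
  obtain ⟨i, j, hij, hi, hj⟩ := isHomogeneous_factors hp hp0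
  obtain rfl : i = k := hi.inj_right hq (left_ne_zero_of_mul hp0)
  obtain rfl : j = 0 := by omega
  obtain ⟨c, rfl⟩ := eq_C_of_isHomogeneous_zero hj
  refine ⟨c, ?_, mul_comm _ _⟩
  rintro rfl
  simp at hp0

theorem map_conj_ne_zero {n : ℕ} {p : MvPolynomial (Fin n) ℂ} (hp : p ≠ 0) :
    map (starRingEnd ℂ) p ≠ 0 :=
  fun h => hp (map_injective _ (starRingEnd ℂ).injective (by rw [h, map_zero]))

/-- A real quartic form with at least three, but finitely many, real zeros is not a product of
two complex quadratic forms proportional to their conjugates. -/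
theorem false_of_conj_factors {f : MvPolynomial (Fin 4) ℝ} (hf : f.IsHomogeneous 4)
    (hcard : 3 ≤ (realZeros f).ncard) {p q : MvPolynomial (Fin 4) ℂ} (hp : p.IsHomogeneous 2)
    (hq : q.IsHomogeneous 2) (hpq : map (algebraMap ℝ ℂ) f = p * q) {c c' : ℂ}
    (hc : map (starRingEnd ℂ) p = C c * p) (hc' : map (starRingEnd ℂ) q = C c' * q) : False := by
  have hfin : (realZeros f).Finite := Set.finite_of_ncard_pos (by omega)
  obtain ⟨D, hD, hD'⟩ := exists_real_form_of_conj hp hc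
  obtain ⟨E, hE, hE'⟩ := exists_real_form_of_conj hq hc'
  have hunion : realZeros f = realZeros D ∪ realZeros E := by
    ext a
    induction a using Projectivization.ind with | h x hx =>
    rw [Set.mem_union, mk_mem_realZeros_iff hf, mk_mem_realZeros_iff hD, mk_mem_realZeros_iff hE,
      ← hD', ← hE', ← mul_eq_zero, ← map_mul, ← hpq, eval_map_ofReal, Complex.ofReal_eq_zero]
  rw [hunion] at hfin hcard
  have hD1 := hfin.subset Set.subset_union_left
  have hE1 := hfin.subset Set.subset_union_right
  have h1 := ncard_realZeros_quadratic_le_one hD hD1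
  have h2 := ncard_realZeros_quadratic_le_one hE hE1
  have := Set.ncard_union_le (realZeros D) (realZeros E)
  omega

/-- An extremal quartic form with finitely many real zeros is not, up to a constant, a complex
quadratic form times its conjugate. -/
theorem false_of_conj_mul {f : MvPolynomial (Fin 4) ℝ} (hf : f ∈ extremals (PSD 4 4))
    (hcard : 2 ≤ (realZeros f).ncard) {p : MvPolynomial (Fin 4) ℂ} (hp : p.IsHomogeneous 2) {c : ℂ}
    (hpq : map (algebraMap ℝ ℂ) f = C c * (p * map (starRingEnd ℂ) p)) : False := by
  have hA := isHomogeneous_rePart hp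
  have hB := isHomogeneous_imPart hp
  have hval : ∀ x : Fin 4 → ℝ,
      eval x f = c.re * (eval x (rePart p) ^ 2 + eval x (imPart p) ^ 2) := by
    intro x
    have h := congrArg (eval fun i => (x i : ℂ)) hpq
    rw [eval_map_ofReal, map_mul, map_mul, eval_C, eval_map_conj, Complex.mul_conj,
      Complex.normSq_apply, eval_ofReal_re, eval_ofReal_im] at h
    have h' := congrArg Complex.re h
    rw [Complex.ofReal_re, Complex.re_mul_ofReal] at h'
    rw [h']
    ring
  have hr : 0 < c.re := by
    by_contra! hr
    refine hf.2.1 (MvPolynomial.funext fun x => ?_)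
    rw [map_zero]
    refine le_antisymm ?_ (hf.1.2 x trivial)
    rw [hval]
    exact mul_nonpos_of_nonpos_of_nonneg hr (by positivity)
  have hsum : C c.re * rePart p ^ 2 + C c.re * imPart p ^ 2 = f := by
    refine MvPolynomial.funext fun x => ?_
    rw [hval]
    simp only [map_add, map_mul, map_pow, eval_C]
    ring
  have hpsd : ∀ q : MvPolynomial (Fin 4) ℝ, q.IsHomogeneous 2 → C c.re * q ^ 2 ∈ PSD 4 4 :=
    fun q hq => ⟨(hq.pow 2).C_mul _, fun x _ => by
      rw [map_mul, map_pow, eval_C]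
      positivity⟩
  have h1 := eq_zero_of_sq_add_eq_extremal hf hcard hr hA (hpsd _ hB) hsum
  have h2 := eq_zero_of_sq_add_eq_extremal hf hcard hr hB (hpsd _ hA) ((add_comm _ _).trans hsum)
  refine hf.2.1 ?_
  rw [← hsum, h1, h2]
  simp

/-- Take an irreducible factor `p` with cofactor `q`; both are homogeneous. Degree one is excluded
by finiteness of the zero set, so either `q` is constant or both have degree two. -/
theorem irreducible_of_extremal {f : MvPolynomial (Fin 4) ℝ} (hf : f ∈ extremals (PSD 4 4))
    (hcard : 3 ≤ (realZeros f).ncard) : Irreducible (map (algebraMap ℝ ℂ) f) := by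
  have hfin : (realZeros f).Finite := Set.finite_of_ncard_pos (by omega)
  have hhom : (map (algebraMap ℝ ℂ) f).IsHomogeneous 4 := IsHomogeneous.map hf.1.1 _
  have hF0 : map (algebraMap ℝ ℂ) f ≠ 0 := fun h =>
    hf.2.1 (map_injective _ (algebraMap ℝ ℂ).injective (by rw [h, map_zero]))
  have hunit : ¬ IsUnit (map (algebraMap ℝ ℂ) f) := by
    intro h
    obtain ⟨i, hi⟩ := h.exists_right_inv
    obtain ⟨a, b, hab, ha, -⟩ := isHomogeneous_factors (hi ▸ isHomogeneous_one _ _)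
      (hi ▸ one_ne_zero)
    have := ha.inj_right hhom hF0
    omega
  obtain ⟨p, hp, q, hpq⟩ := WfDvdMonoid.exists_irreducible_factor hunit hF0
  obtain ⟨i, j, hij, hi, hj⟩ := isHomogeneous_factors (hpq ▸ hhom) (hpq ▸ hF0)
  have hp0 := hp.ne_zero
  have hq0 : q ≠ 0 := by
    rintro rfl
    rw [mul_zero] at hpq
    exact hF0 hpq
  have hi0 : i ≠ 0 := by
    rintro rfl
    obtain ⟨c, rfl⟩ := eq_C_of_isHomogeneous_zero hi
    exact hp.not_isUnit ((isUnit_iff_ne_zero.2 fun h => hp0 (by rw [h, C_0])).map C)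
  have hi1 : i ≠ 1 := by
    rintro rfl
    exact infinite_realZeros_of_linear_factor hf.1.1 hi ⟨q, hpq⟩ hfin
  have hj1 : j ≠ 1 := by
    rintro rfl
    exact infinite_realZeros_of_linear_factor hf.1.1 hj ⟨p, by rw [hpq, mul_comm]⟩ hfin
  by_cases hj0 : j = 0
  · subst hj0
    obtain ⟨c, rfl⟩ := eq_C_of_isHomogeneous_zero hj
    rw [hpq]
    exact (irreducible_mul_isUnit
      ((isUnit_iff_ne_zero.2 fun h => hq0 (by rw [h, C_0])).map C)).2 hp
  obtain rfl : i = 2 := by omega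
  obtain rfl : j = 2 := by omega
  exfalso
  -- The product is real, so the prime `p` divides the conjugate of `p` or that of `q`. The degrees
  -- agree, so it is proportional to it.
  have hconj : p * q = map (starRingEnd ℂ) p * map (starRingEnd ℂ) q := by
    rw [← map_mul, ← hpq, map_conj_map_ofReal]
  rcases hp.prime.dvd_or_dvd (hconj ▸ dvd_mul_right p q) with h | h
  · obtain ⟨c, hc0, hc⟩ := eq_C_mul_of_dvd (hi.map _) hi (map_conj_ne_zero hp0) h
    refine false_of_conj_factors hf.1.1 hcard hi hj hpq (c' := c⁻¹) hc ?_
    have hcc : (C c⁻¹ : MvPolynomial (Fin 4) ℂ) * C c = 1 := by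
      rw [← C_mul, inv_mul_cancel₀ hc0, C_1]
    refine mul_left_cancel₀ hp0 ?_
    rw [hc] at hconj
    linear_combination (-(C c⁻¹)) * hconj - p * map (starRingEnd ℂ) q * hcc
  · obtain ⟨c, hc0, hc⟩ := eq_C_mul_of_dvd (hj.map _) hi (map_conj_ne_zero hq0) h
    have hq : q = C (starRingEnd ℂ c) * map (starRingEnd ℂ) p := by
      have := congrArg (map (starRingEnd ℂ)) hc
      rw [map_map, map_mul, map_C] at this
      have hid : (starRingEnd ℂ).comp (starRingEnd ℂ) = RingHom.id ℂ :=
        RingHom.ext fun x => by simp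
      rw [← this, hid, MvPolynomial.map_id]
    refine false_of_conj_mul hf (by omega) hi (c := starRingEnd ℂ c) ?_
    rw [hpq]
    conv_lhs => rw [hq]
    ring

end SymQuartic

end

/-! ### The main theorem -/

theorem theorem1p9 :
    -- the parameter set is a non-empty open subset of the plane
    IsOpen SymQuartic.paramSet ∧ SymQuartic.paramSet.Nonempty ∧
    -- the properties of the quartics with parameters in this set
    (∀ t u : ℝ, (t, u) ∈ SymQuartic.paramSet →
      SymQuartic.quartic t u ∈ SymQuartic.SymPSD 4 4 ∧
      MvPolynomial.eval ![t, 1, 1, 1] (SymQuartic.quartic t u) = 0 ∧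
      MvPolynomial.eval ![u, u, 1, 1] (SymQuartic.quartic t u) = 0 ∧
      SymQuartic.quartic t u ∈ SymQuartic.extremals (SymQuartic.PSD 4 4) ∧
      SymQuartic.quartic t u ∉ SymQuartic.SOS 4 2 ∧
      Irreducible (MvPolynomial.map (algebraMap ℝ ℂ) (SymQuartic.quartic t u)) ∧
      (SymQuartic.realZeros (SymQuartic.quartic t u)).ncard = 10 ∧
      IsDiscrete (SymQuartic.realZeros (SymQuartic.quartic t u))) ∧
    -- which of the quartics are positive semidefinite
    (∀ t u : ℝ, u ≠ 0 → u ≠ 1 →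
      (SymQuartic.quartic t u ∈ SymQuartic.SymPSD 4 4 ↔
        0 ≤ SymQuartic.VF t (SymQuartic.omega u))) ∧
    (∀ t u : ℝ, u ≠ 0 → (t, u) ≠ (1, 1) →
      -SymQuartic.quartic t u ∉ SymQuartic.SymPSD 4 4) ∧
    -- irreducibility and failure to be a sum of squares whenever the quartic is extremal
    (∀ t u : ℝ, t ≠ 1 → u ≠ 0 → u ≠ 1 → u ≠ -1 →
      0 < SymQuartic.VF t (SymQuartic.omega u) →
      SymQuartic.quartic t u ∈ SymQuartic.extremals (SymQuartic.PSD 4 4) →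
      Irreducible (MvPolynomial.map (algebraMap ℝ ℂ) (SymQuartic.quartic t u)) ∧
      SymQuartic.quartic t u ∉ SymQuartic.SOS 4 2) := by
  refine ⟨SymQuartic.isOpen_paramSet, SymQuartic.paramSet_nonempty, ?_,
    fun t u hu hu1 => SymQuartic.quartic_mem_SymPSD_iff hu hu1,
    fun t u hu htu => SymQuartic.neg_quartic_notMem_SymPSD hu htu, ?_⟩
  · rintro t u ⟨-, ht, hu, hu1, hu2, htu, -, -, hV⟩
    have hcard := SymQuartic.ncard_realZeros_quartic ht hu hu1 hu2 hV
    have hext := SymQuartic.quartic_mem_extremals ht hu hu1 hu2 htu hV.le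
    exact ⟨(SymQuartic.quartic_mem_SymPSD_iff hu hu1).2 hV.le,
      SymQuartic.eval_quartic_triple t u, SymQuartic.eval_quartic_pair t hu, hext,
      SymQuartic.notMem_SOS_of_extremal hext (by rw [hcard]; norm_num),
      SymQuartic.irreducible_of_extremal hext (by rw [hcard]; norm_num), hcard,
      SymQuartic.isDiscrete_realZeros_quartic ht hu hV⟩
  · intro t u ht hu hu1 hu2 hV hext
    have hcard := SymQuartic.ncard_realZeros_quartic ht hu hu1 hu2 hV
    exact ⟨SymQuartic.irreducible_of_extremal hext (by rw [hcard]; norm_num),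
      SymQuartic.notMem_SOS_of_extremal hext (by rw [hcard]; norm_num)⟩
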